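/- Let $k\neq 0$ be a real constant and let $g$ be the Petrov homogeneous metric on $\mathbb R^4$ with coordinates $(x,y,z,t)$, $$k^2 g = dx^2 + e^{-2x}\,dy^2 + e^{x}\left(\cos(\sqrt3\,x)\,(dz^2-dt^2) - 2\sin(\sqrt3\,x)\,dz\,dt\right),$$ with either orientation, and let $U\subseteq\mathbb R^4$ be a non-empty connected open set (for instance $U=\mathbb R^4$). Notation. Let $*$ be the Hodge dual, $W$ the Weyl tensor and $\mathcal W=\frac12(W-\mathrm i *W)$ the self-dual Weyl tensor, acting on 2-forms by $\mathcal W(F)_{ab}=\frac12\mathcal W_{abcd}F^{cd}$. A Weyl principal bivector on $U$ is a smooth, nowhere zero complex 2-form $\mathcal U$ with $*\mathcal U=\mathrm i\,\mathcal U$ that is at every point an eigenvector of $\mathcal W$. A Weyl principal frame on $U$ is a smooth orthonormal frame $\{e_0,e_1,e_2,e_3\}$ ($e_0$ timelike) such that, with $U_i=e_0\wedge e_i$ (indices lowered with $g$), the bivectors $\mathcal U_i=\frac1{\sqrt2}(U_i-\mathrm i*U_i)$, $i=1,2,3$, satisfy $\mathcal W(\mathcal U_i)=\alpha_i\,\mathcal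 U_i$; the functions $\alpha_i$ are the Weyl eigenvalues, and the complex connection 1-forms $\Gamma_i^j=-\Gamma_j^i$ are defined by $\nabla\mathcal U_i=\sum_j\Gamma_i^j\otimes\mathcal U_j$. The Papapetrou field of a (real, smooth) Killing field $\xi$ is the 2-form $\nabla\xi$, $(\nabla\xi)_{ab}=\nabla_a\xi_b$; it is aligned with a bivector $\mathcal U$ if $\nabla\xi=\Omega\,\mathcal U+\overline{\Omega\,\mathcal U}$ for some complex function $\Omega$. Proposition. The metric $g$ is a vacuum solution ($\mathrm{Ric}=0$) of Petrov type I: there is a Weyl principal frame on $U$, with pairwise distinct eigenvalues, and for every Weyl principal frame on $U$ exactly one of the three eigenvalues is real; the frame can be numbered so that this is $\alpha_3$. Moreover, $g$ admits on $U$ exactly one Killing field, up to a constant factor, whose Papapetrou field is aligned with a Weyl principal bivector: there is a nowhere vanishing Killing field $\xi_0$ on $U$ with this property, and every Killing field on $U$ with this property is $c\,\xi_0$ for a real constant $c$. If a Weyl principal frame on $U$ is numbered so that $\alpha_3$ is the real eigenvalue, then its connection 1-forms exist, $\Gamma_1^2=f\,g(\xi_0,\cdot)$ for a nowhere zero real function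 $f$ on $U$ (that is, $\xi_0$ is proportional to $\Gamma_1^2$), and the Papapetrou field of $\xi_0$ is aligned with $\mathcal U_3$. -/

import Mathlib

open scoped ContDiff

noncomputable section

namespace Petrov

/-- The coordinate space `ℝ⁴`; in the Petrov solution the coordinates with indices `0, 1, 2, 3`
are `x, y, z, t`. -/
abbrev Pt : Type := Fin 4 → ℝ

/-- A metric tensor, given by its matrix of components `g_{ab}` in the coordinates. -/
abbrev MetricField : Type := Pt → Matrix (Fin 4) (Fin 4) ℝ

/-- A field of complex covariant 2-tensors, given by its components `F_{ab}`. -/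
abbrev TwoTensor : Type := Pt → Fin 4 → Fin 4 → ℂ

/-- The partial derivative `∂_a f`. -/
def pd {F : Type*} [NormedAddCommGroup F] [NormedSpace ℝ F] (a : Fin 4) (f : Pt → F) (p : Pt) : F :=
  fderiv ℝ f p (Pi.single a 1)

/-- The metric `k² g = dx² + e^{-2x} dy² + e^x (cos(√3 x) (dz² - dt²) - 2 sin(√3 x) dz dt)`. -/
def petrovMetric (k : ℝ) : MetricField := fun p =>
  (k ^ 2)⁻¹ •
    !![1, 0, 0, 0;
       0, Real.exp (-2 * p 0), 0, 0;
       0, 0, Real.exp (p 0) * Real.cos (√3 * p 0), -(Real.exp (p 0) * Real.sin (√3 * p 0));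
       0, 0, -(Real.exp (p 0) * Real.sin (√3 * p 0)), -(Real.exp (p 0) * Real.cos (√3 * p 0))]

section Curvature

/-- The Christoffel symbols `Γ^c_{ab}` of the Levi-Civita connection. -/
def christoffel (g : MetricField) (c a b : Fin 4) (p : Pt) : ℝ :=
  2⁻¹ * ∑ d, (g p)⁻¹ c d *
    (pd a (fun q => g q d b) p + pd b (fun q => g q d a) p - pd d (fun q => g q a b) p)

/-- The Riemann tensor `R^a_{bcd}`. -/
def riemann (g : MetricField) (a b c d : Fin 4) (p : Pt) : ℝ :=
  pd c (christoffel g a d b) p - pd d (christoffel g a c b) p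
    + ∑ e, (christoffel g a c e p * christoffel g e d b p
        - christoffel g a d e p * christoffel g e c b p)

/-- The Riemann tensor with its first index lowered, `R_{abcd}`. -/
def riemannLow (g : MetricField) (a b c d : Fin 4) (p : Pt) : ℝ :=
  ∑ e, g p a e * riemann g e b c d p

/-- The Ricci tensor `R_{bd} = R^a_{bad}`. -/
def ricci (g : MetricField) (b d : Fin 4) (p : Pt) : ℝ :=
  ∑ a, riemann g a b a d p

/-- The scalar curvature. -/
def scalarCurv (g : MetricField) (p : Pt) : ℝ :=
  ∑ a, ∑ b, (g p)⁻¹ a b * ricci g a b p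

/-- The Weyl tensor `W_{abcd}` in dimension four. -/
def weyl (g : MetricField) (a b c d : Fin 4) (p : Pt) : ℝ :=
  riemannLow g a b c d p
    - 2⁻¹ * (g p a c * ricci g b d p - g p a d * ricci g b c p
        - g p b c * ricci g a d p + g p b d * ricci g a c p)
    + scalarCurv g p / 6 * (g p a c * g p b d - g p a d * g p b c)

/-- The metric volume element `η_{abcd} = ± |det g|^{1/2} ε_{abcd}`. The unit `σ` is the choice of
orientation, and the determinant in the formula is the Levi-Civita symbol `ε_{abcd}`. -/
def volForm (σ : ℤˣ) (g : MetricField) (a b c d : Fin 4) (p : Pt) : ℝ :=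
  ((σ : ℤ) : ℝ) * √|(g p).det| * ((1 : Matrix (Fin 4) (Fin 4) ℝ).submatrix ![a, b, c, d] id).det

/-- The 2-tensor `F` with both indices raised, `F^{ab}`. -/
def raise (g : MetricField) (F : TwoTensor) (a b : Fin 4) (p : Pt) : ℂ :=
  ∑ c, ∑ d, (((g p)⁻¹ a c * (g p)⁻¹ b d : ℝ) : ℂ) * F p c d

/-- The Hodge dual of a 2-form, `(*F)_{ab} = ½ η_{abcd} F^{cd}`. -/
def hodge (σ : ℤˣ) (g : MetricField) (F : TwoTensor) : TwoTensor := fun p a b =>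
  2⁻¹ * ∑ c, ∑ d, (volForm σ g a b c d p : ℂ) * raise g F c d p

/-- The self-dual Weyl tensor `𝒲 = ½ (W - i *W)`. -/
def selfDualWeyl (σ : ℤˣ) (g : MetricField) (a b c d : Fin 4) (p : Pt) : ℂ :=
  2⁻¹ * ((weyl g a b c d p : ℂ)
    - Complex.I * hodge σ g (fun q m n => (weyl g m n c d q : ℂ)) p a b)

/-- The self-dual Weyl tensor as an endomorphism of 2-forms, `𝒲(F)_{ab} = ½ 𝒲_{abcd} F^{cd}`. -/
def weylMap (σ : ℤˣ) (g : MetricField) (F : TwoTensor) : TwoTensor := fun p a b =>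
  2⁻¹ * ∑ c, ∑ d, selfDualWeyl σ g a b c d p * raise g F c d p

end Curvature

section Killing

/-- The 1-form metrically equivalent to the vector field `ξ`. -/
def flat (g : MetricField) (ξ : Pt → Pt) (a : Fin 4) (p : Pt) : ℝ :=
  ∑ b, g p a b * ξ p b

/-- The covariant derivative `(∇ξ)_{ab} = ∇_a ξ_b`; when `ξ` is a Killing field this is its
Papapetrou field. -/
def papapetrou (g : MetricField) (ξ : Pt → Pt) (a b : Fin 4) (p : Pt) : ℝ :=
  pd a (flat g ξ b) p - ∑ c, christoffel g c a b p * flat g ξ c p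

/-- `ξ` is a smooth Killing field of `g` on `U`: `∇_a ξ_b + ∇_b ξ_a = 0`. -/
def IsKilling (g : MetricField) (U : Set Pt) (ξ : Pt → Pt) : Prop :=
  ContDiffOn ℝ ∞ ξ U ∧
    ∀ p ∈ U, ∀ a b, papapetrou g ξ a b p + papapetrou g ξ b a p = 0

/-- `F` is a Weyl principal bivector on `U`: a smooth, nowhere zero, self-dual 2-form that is an
eigenbivector of the self-dual Weyl tensor at every point. -/
def IsPrincipalBivector (σ : ℤˣ) (g : MetricField) (U : Set Pt) (F : TwoTensor) : Prop :=
  ContDiffOn ℝ ∞ F U ∧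
    ∀ p ∈ U, F p ≠ 0 ∧ (∀ a b, F p a b = -F p b a) ∧ hodge σ g F p = Complex.I • F p ∧
      ∃ α : ℂ, weylMap σ g F p = α • F p

/-- The Papapetrou field of `ξ` is aligned with the bivector `F` on `U`:
`∇ξ = Ω F + conj (Ω F)` for some complex function `Ω`. -/
def AlignedWith (g : MetricField) (U : Set Pt) (ξ : Pt → Pt) (F : TwoTensor) : Prop :=
  ∃ Ω : Pt → ℂ, ∀ p ∈ U, ∀ a b,
    (papapetrou g ξ a b p : ℂ) = Ω p * F p a b + (starRingEnd ℂ) (Ω p * F p a b)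

/-- The Papapetrou field of `ξ` is aligned on `U` with some Weyl principal bivector. -/
def IsAligned (σ : ℤˣ) (g : MetricField) (U : Set Pt) (ξ : Pt → Pt) : Prop :=
  ∃ F : TwoTensor, IsPrincipalBivector σ g U F ∧ AlignedWith g U ξ F

end Killing

section Frame

/-- The bivector `𝒰_i = (1/√2) (U_i - i *U_i)`, `U_i = e_0 ∧ e_i`, of a tetrad `e`. It is
normalized by `2 𝒰_i × 𝒰_i = g` when `e` is orthonormal. The index `i = 0, 1, 2` here stands for
`1, 2, 3`. -/
def frameBivector (σ : ℤˣ) (g : MetricField) (e : Fin 4 → Pt → Pt) (i : Fin 3) : TwoTensor :=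
  let V : TwoTensor := fun p a b =>
    ((flat g (e 0) a p * flat g (e i.succ) b p - flat g (e 0) b p * flat g (e i.succ) a p : ℝ) : ℂ)
  fun p a b => ((√2 : ℝ) : ℂ)⁻¹ * (V p a b - Complex.I * hodge σ g V p a b)

/-- `e` is a Weyl principal frame on `U` with eigenvalues `α`: a smooth orthonormal tetrad (with
`e 0` timelike) whose bivectors satisfy `𝒲(𝒰_i) = α_i 𝒰_i`. -/
def IsPrincipalFrame (σ : ℤˣ) (g : MetricField) (U : Set Pt) (e : Fin 4 → Pt → Pt)
    (α : Fin 3 → Pt → ℂ) : Prop :=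
  (∀ m, ContDiffOn ℝ ∞ (e m) U) ∧
    ∀ p ∈ U,
      (∀ m n, ∑ a, flat g (e m) a p * e n p a = if m = n then (if m = 0 then -1 else 1) else 0) ∧
      ∀ i, weylMap σ g (frameBivector σ g e i) p = α i p • frameBivector σ g e i p

/-- The covariant derivative of a 2-tensor, `∇_c F_{ab}`. -/
def covDeriv (g : MetricField) (F : TwoTensor) (c a b : Fin 4) (p : Pt) : ℂ :=
  pd c (fun q => F q a b) p
    - ∑ d, ((christoffel g d c a p : ℂ) * F p d b + (christoffel g d c b p : ℂ) * F p a d)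

/-- `Γ i j` are the complex connection 1-forms `Γ_i^j` of the frame `𝒰` on `U`: they are
antisymmetric in `i, j`, and `∇𝒰_i = Γ_i^j ⊗ 𝒰_j`. -/
def IsConnection (g : MetricField) (U : Set Pt) (B : Fin 3 → TwoTensor)
    (Γ : Fin 3 → Fin 3 → Pt → Fin 4 → ℂ) : Prop :=
  ∀ p ∈ U, (∀ i j c, Γ i j p c = -Γ j i p c) ∧
    ∀ i c a b, covDeriv g (B i) c a b p = ∑ j, Γ i j p c * B j p a b

end Frame

end Petrov

end

open scoped ContDiff Topology

noncomputable section

namespace Petrov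

/-! Up to the constant factor `k⁻²` the metric is `dx² + γ(x)`, with flat slices `x = const` and `γ'
= 2γK` for a constant matrix `K` (`shapeTab`) whose eigenvalues `-1`, `e^{±iπ/3}` are the three cube
roots of `-1`. The Gauss equation and `R^a_{xbx} = -K²` give the whole curvature (`riemannTab`).
Since `tr K = tr K² = 0`, the metric is Ricci flat, and the Weyl tensor is the Riemann tensor.

A self-dual 2-form is determined by its components `(u, v, w) = (F_xy, F_xz, F_xt)` (`sdTab`), and
on these triples the self-dual Weyl tensor is `k²` times the transpose of `-K²` (`weylMap_sdTab`).
Its eigenvalues `-k²`, `k² e^{±iπ/3}` are distinct and exactly one is real. The eigenvectors are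
`(1, 0, 0)` and `(0, 1, ±i)`, so a continuous eigenbivector on a connected set keeps its type
(`eigenvector_cases_on`). The bivectors of an orthonormal tetrad are pairwise orthogonal and not
null, hence the three of a principal frame have three different types (`exists_eigenType`).
Existence of a frame is shown by an explicit one, `petrovFrame`.

For a Killing field, Kostant's identity `∇_c ∇_a ξ_b = R^d_{cab} ξ_d` (`pd_papapetrou`) turns the
vanishing of a component of `∇ξ` on an open set into linear equations for `ξ` and `∇ξ`. Alignment
with an eigenbivector makes either `(∇ξ)_xz` and `(∇ξ)_xt` or `(∇ξ)_xy` vanish. In both cases the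
equations leave only the `y` component of `ξ`, and the Killing equation makes it constant. So `∂_y`
is the only candidate, and `∇∂_y` is proportional to `dx ∧ dy`, which is the real part of a bivector
belonging to the real eigenvalue.

The normalization of a principal frame fixes each bivector up to sign, because the square of its one
free component is known. Differentiating that square yields all `∇𝒰_i`, hence the connection
(`covDeriv_frameBivector`). There `Γ_1^2` has only a `dy` component, whose square is `e^{-2x} > 0`.
It is therefore real, nonzero and proportional to the 1-form of `∂_y`. -/

/-- The Levi-Civita symbol as a Vandermonde product. -/
theorem leviCivita_eq (a b c d : Fin 4) :
    ((1 : Matrix (Fin 4) (Fin 4) ℝ).submatrix ![a, b, c, d] id).det =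
      (((b : ℕ) : ℝ) - (a : ℕ)) * ((c : ℕ) - (a : ℕ)) * ((d : ℕ) - (a : ℕ)) * ((c : ℕ) - (b : ℕ)) *
        ((d : ℕ) - (b : ℕ)) * ((d : ℕ) - (c : ℕ)) / 12 := by
  -- For a permutation of `0, 1, 2, 3` the Vandermonde product is `±1!·2!·3! = ±12`, and it vanishes
  -- on repeated indices. Over `ℤ` the 256 cases are decidable.
  have key : ∀ a b c d : Fin 4,
      12 * ((1 : Matrix (Fin 4) (Fin 4) ℤ).submatrix ![a, b, c, d] id).det =
      (((b : ℕ) : ℤ) - (a : ℕ)) * ((c : ℕ) - (a : ℕ)) * ((d : ℕ) - (a : ℕ)) * ((c : ℕ) - (b : ℕ)) *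
        ((d : ℕ) - (b : ℕ)) * ((d : ℕ) - (c : ℕ)) := by
    decide +kernel
  have hmap : (1 : Matrix (Fin 4) (Fin 4) ℝ).submatrix ![a, b, c, d] id =
      ((1 : Matrix (Fin 4) (Fin 4) ℤ).submatrix ![a, b, c, d] id).map (Int.castRingHom ℝ) := by
    ext i j
    simp only [Matrix.submatrix_apply, Matrix.map_apply, Matrix.one_apply]
    split_ifs <;> simp
  have := congrArg (Int.castRingHom ℝ) (key a b c d)
  rw [map_mul, RingHom.map_det] at this
  rw [hmap]
  simp only [RingHom.mapMatrix_apply] at this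
  push_cast at this
  simp only [Int.coe_castRingHom] at this ⊢
  push_cast at this
  linarith

/-! ### The metric in coordinates -/

/-- The component `e^{-2x}` of the rescaled metric. -/
def fA (p : Pt) : ℝ := Real.exp (-2 * p 0)

/-- The component `e^x cos(√3 x)` of the rescaled metric. -/
def fC (p : Pt) : ℝ := Real.exp (p 0) * Real.cos (√3 * p 0)

/-- The component `e^x sin(√3 x)` of the rescaled metric. -/
def fS (p : Pt) : ℝ := Real.exp (p 0) * Real.sin (√3 * p 0)

theorem fA_pos (p : Pt) : 0 < fA p := Real.exp_pos _

theorem fC_sq_add_fS_sq (p : Pt) : fC p ^ 2 + fS p ^ 2 = Real.exp (p 0) ^ 2 := by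
  rw [fC, fS, mul_pow, mul_pow, ← mul_add, Real.cos_sq_add_sin_sq, mul_one]

/-- The exponentials cancel, which says that the rescaled metric has determinant `-1`. Together with
`√3² = 3` this is the relation that closes most of the component computations; exponentials and
trigonometric functions are otherwise treated as unknowns. -/
theorem fA_mul (p : Pt) : fA p * (fC p ^ 2 + fS p ^ 2) = 1 := by
  rw [fC_sq_add_fS_sq, fA, pow_two, ← Real.exp_add, ← Real.exp_add, ← Real.exp_zero]
  ring_nf

theorem sqrt_three_sq : √3 ^ 2 = 3 := Real.sq_sqrt (by norm_num)

/-- Partial derivatives of a function of the coordinate `x` alone. -/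
theorem pd_comp_coord {F : Type*} [NormedAddCommGroup F] [NormedSpace ℝ F] {φ : ℝ → F} {φ' : F}
    {p : Pt} (h : HasDerivAt φ φ' (p 0)) (c : Fin 4) :
    pd c (fun q : Pt => φ (q 0)) p = if c = 0 then φ' else 0 := by
  have h2 : HasFDerivAt (fun q : Pt => q 0) (ContinuousLinearMap.proj (R := ℝ) 0) p :=
    (ContinuousLinearMap.proj (R := ℝ) (φ := fun _ : Fin 4 => ℝ) 0).hasFDerivAt
  have h3 := h.hasFDerivAt.comp p h2
  unfold pd
  erw [h3.fderiv]
  by_cases hc : c = 0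
  · subst hc; simp
  · simp [hc, Ne.symm hc]

theorem hasDerivAt_fA (x : ℝ) :
    HasDerivAt (fun x : ℝ => Real.exp (-2 * x)) (-2 * Real.exp (-2 * x)) x := by
  have := ((hasDerivAt_id x).const_mul (-2)).exp
  simpa [mul_comm] using this

theorem hasDerivAt_fC (x : ℝ) :
    HasDerivAt (fun x : ℝ => Real.exp x * Real.cos (√3 * x))
      (Real.exp x * Real.cos (√3 * x) - √3 * (Real.exp x * Real.sin (√3 * x))) x := by
  have := (Real.hasDerivAt_exp x).mul (((hasDerivAt_id x).const_mul √3).cos)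
  exact this.congr_deriv (by simp only [id]; ring)

theorem hasDerivAt_fS (x : ℝ) :
    HasDerivAt (fun x : ℝ => Real.exp x * Real.sin (√3 * x))
      (Real.exp x * Real.sin (√3 * x) + √3 * (Real.exp x * Real.cos (√3 * x))) x := by
  have := (Real.hasDerivAt_exp x).mul (((hasDerivAt_id x).const_mul √3).sin)
  exact this.congr_deriv (by simp only [id]; ring)

/-- The components of the rescaled metric. -/
def metricTab (p : Pt) : Matrix (Fin 4) (Fin 4) ℝ :=
  !![1, 0, 0, 0; 0, fA p, 0, 0; 0, 0, fC p, -fS p; 0, 0, -fS p, -fC p]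

/-- The derivative in `x` of the components of the rescaled metric. -/
def metricTab' (p : Pt) : Matrix (Fin 4) (Fin 4) ℝ :=
  !![0, 0, 0, 0; 0, -2 * fA p, 0, 0; 0, 0, fC p - √3 * fS p, -(fS p + √3 * fC p);
     0, 0, -(fS p + √3 * fC p), -(fC p - √3 * fS p)]

/-- The components of the inverse of the rescaled metric. -/
def invTab (p : Pt) : Matrix (Fin 4) (Fin 4) ℝ :=
  !![1, 0, 0, 0; 0, fC p ^ 2 + fS p ^ 2, 0, 0; 0, 0, fA p * fC p, -(fA p * fS p);
     0, 0, -(fA p * fS p), -(fA p * fC p)]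

theorem petrovMetric_eq (k : ℝ) (p : Pt) : petrovMetric k p = (k ^ 2)⁻¹ • metricTab p := rfl

theorem petrovMetric_apply (k : ℝ) (p : Pt) (a b : Fin 4) :
    petrovMetric k p a b = (k ^ 2)⁻¹ * metricTab p a b := rfl

theorem metricTab_mul_invTab (p : Pt) : metricTab p * invTab p = 1 := by
  have h := fA_mul p
  ext i j
  fin_cases i <;> fin_cases j <;>
    simp [metricTab, invTab, Matrix.mul_apply, Fin.sum_univ_four] <;> linarith

theorem petrovMetric_inv {k : ℝ} (hk : k ≠ 0) (p : Pt) :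
    (petrovMetric k p)⁻¹ = k ^ 2 • invTab p := by
  apply Matrix.inv_eq_right_inv
  rw [petrovMetric_eq, Matrix.smul_mul, Matrix.mul_smul, metricTab_mul_invTab, smul_smul,
    inv_mul_cancel₀ (pow_ne_zero 2 hk), one_smul]

theorem det_petrovMetric (k : ℝ) (p : Pt) : (petrovMetric k p).det = -((k ^ 2)⁻¹) ^ 4 := by
  have h := fA_mul p
  have : (metricTab p).det = -1 := by
    simp [metricTab, Matrix.det_succ_row_zero, Fin.sum_univ_succ, Fin.succAbove]
    linarith
  rw [petrovMetric_eq, Matrix.det_smul, this]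
  simp

theorem pd_metricTab (p : Pt) (c a b : Fin 4) :
    pd c (fun q => metricTab q a b) p = if c = 0 then metricTab' p a b else 0 := by
  have hA := pd_comp_coord (hasDerivAt_fA (p 0)) c
  have hC := pd_comp_coord (hasDerivAt_fC (p 0)) c
  have hS := pd_comp_coord (hasDerivAt_fS (p 0)).neg c
  have hC' := pd_comp_coord (hasDerivAt_fC (p 0)).neg c
  have h0 := pd_comp_coord (p := p) (hasDerivAt_const (p 0) (0 : ℝ)) c
  have h1 := pd_comp_coord (p := p) (hasDerivAt_const (p 0) (1 : ℝ)) c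
  fin_cases a <;> fin_cases b <;> first | exact h0 | exact h1 | exact hA | exact hC | exact hS | exact hC'

theorem pd_petrovMetric (k : ℝ) (p : Pt) (c a b : Fin 4) :
    pd c (fun q => petrovMetric k q a b) p =
      (k ^ 2)⁻¹ * if c = 0 then metricTab' p a b else 0 := by
  rw [← pd_metricTab]
  unfold pd
  simp_rw [petrovMetric_apply]
  rw [show (fun q => (k ^ 2)⁻¹ * metricTab q a b) = (k ^ 2)⁻¹ • (fun q => metricTab q a b) from rfl,
    fderiv_const_smul_field]
  simp

/-! ### Christoffel symbols and curvature -/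

/-- The Christoffel symbols `Γ^c_{ab}` of the Petrov metric. -/
def christoffelTab (p : Pt) : Fin 4 → Matrix (Fin 4) (Fin 4) ℝ :=
  ![!![0, 0, 0, 0; 0, fA p, 0, 0; 0, 0, -(fC p - √3 * fS p) / 2, (fS p + √3 * fC p) / 2;
       0, 0, (fS p + √3 * fC p) / 2, (fC p - √3 * fS p) / 2],
    !![0, -1, 0, 0; -1, 0, 0, 0; 0, 0, 0, 0; 0, 0, 0, 0],
    !![0, 0, 1 / 2, -√3 / 2; 0, 0, 0, 0; 1 / 2, 0, 0, 0; -√3 / 2, 0, 0, 0],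
    !![0, 0, √3 / 2, 1 / 2; 0, 0, 0, 0; √3 / 2, 0, 0, 0; 1 / 2, 0, 0, 0]]

theorem christoffel_eq {k : ℝ} (hk : k ≠ 0) (c a b : Fin 4) (p : Pt) :
    christoffel (petrovMetric k) c a b p = christoffelTab p c a b := by
  have h := fA_mul p
  have hk2 : k ^ 2 * (k ^ 2)⁻¹ = 1 := mul_inv_cancel₀ (pow_ne_zero 2 hk)
  have key : christoffel (petrovMetric k) c a b p = 2⁻¹ * ∑ d, invTab p c d *
      ((if a = 0 then metricTab' p d b else 0) + (if b = 0 then metricTab' p d a else 0)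
        - (if d = 0 then metricTab' p a b else 0)) := by
    unfold christoffel
    congr 1
    refine Finset.sum_congr rfl fun d _ => ?_
    rw [petrovMetric_inv hk, pd_petrovMetric, pd_petrovMetric, pd_petrovMetric, Matrix.smul_apply,
      smul_eq_mul]
    linear_combination (invTab p c d * ((if a = 0 then metricTab' p d b else 0)
      + (if b = 0 then metricTab' p d a else 0) - (if d = 0 then metricTab' p a b else 0))) * hk2
  rw [key]
  fin_cases c <;> fin_cases a <;> fin_cases b <;>
    simp [Fin.sum_univ_four, invTab, metricTab', christoffelTab] <;>
    first
    | ring1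
    | linear_combination -h
    | linear_combination h
    | linear_combination h / 2
    | linear_combination √3 * h / 2
    | linear_combination -√3 * h / 2

/-- The derivative in `x` of the Christoffel symbols. -/
def christoffelTab' (p : Pt) : Fin 4 → Matrix (Fin 4) (Fin 4) ℝ :=
  ![!![0, 0, 0, 0; 0, -2 * fA p, 0, 0; 0, 0, fC p + √3 * fS p, √3 * fC p - fS p;
       0, 0, √3 * fC p - fS p, -(fC p + √3 * fS p)],
    !![0, 0, 0, 0; 0, 0, 0, 0; 0, 0, 0, 0; 0, 0, 0, 0],
    !![0, 0, 0, 0; 0, 0, 0, 0; 0, 0, 0, 0; 0, 0, 0, 0],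
    !![0, 0, 0, 0; 0, 0, 0, 0; 0, 0, 0, 0; 0, 0, 0, 0]]

theorem pd_christoffel {k : ℝ} (hk : k ≠ 0) (p : Pt) (e c a b : Fin 4) :
    pd e (christoffel (petrovMetric k) c a b) p =
      if e = 0 then christoffelTab' p c a b else 0 := by
  rw [show christoffel (petrovMetric k) c a b = fun q => christoffelTab q c a b from
    funext fun q => christoffel_eq hk c a b q]
  have hA := pd_comp_coord (hasDerivAt_fA (p 0)) e
  have hC := pd_comp_coord (((hasDerivAt_fC (p 0)).sub
    ((hasDerivAt_fS (p 0)).const_mul √3)).div_const 2) e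
  have hC' := pd_comp_coord (((hasDerivAt_fC (p 0)).sub
    ((hasDerivAt_fS (p 0)).const_mul √3)).neg.div_const 2) e
  have hS := pd_comp_coord (((hasDerivAt_fS (p 0)).add
    ((hasDerivAt_fC (p 0)).const_mul √3)).div_const 2) e
  have h0 := fun t : ℝ => pd_comp_coord (p := p) (hasDerivAt_const (p 0) t) e
  fin_cases c <;> fin_cases a <;> fin_cases b <;>
    first
    | exact h0 _
    | exact hA
    | (refine hC.trans ?_
       congr 1
       change _ = -(fC p + √3 * fS p)
       rw [fC, fS]
       linear_combination (-Real.exp (p 0) * Real.cos (√3 * p 0) / 2) * sqrt_three_sq)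
    | (refine hC'.trans ?_
       congr 1
       change _ = fC p + √3 * fS p
       rw [fC, fS]
       linear_combination (Real.exp (p 0) * Real.cos (√3 * p 0) / 2) * sqrt_three_sq)
    | (refine hS.trans ?_
       congr 1
       change _ = √3 * fC p - fS p
       rw [fC, fS]
       linear_combination (-Real.exp (p 0) * Real.sin (√3 * p 0) / 2) * sqrt_three_sq)

/-- The extrinsic curvature `Γ^a_{xb}` of the hypersurfaces `x = const`. -/
def shapeTab : Matrix (Fin 4) (Fin 4) ℝ :=
  !![0, 0, 0, 0; 0, -1, 0, 0; 0, 0, 1 / 2, -√3 / 2; 0, 0, √3 / 2, 1 / 2]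

/-- The electric part `R^a_{xbx}` of the curvature. -/
def tidalTab : Matrix (Fin 4) (Fin 4) ℝ :=
  !![0, 0, 0, 0; 0, -1, 0, 0; 0, 0, 1 / 2, √3 / 2; 0, 0, -√3 / 2, 1 / 2]

/-- The electric part of the curvature with its indices lowered by the rescaled metric. -/
def tidalLowTab (p : Pt) : Matrix (Fin 4) (Fin 4) ℝ :=
  !![0, 0, 0, 0; 0, -fA p, 0, 0; 0, 0, (fC p + √3 * fS p) / 2, (√3 * fC p - fS p) / 2;
     0, 0, (√3 * fC p - fS p) / 2, -(fC p + √3 * fS p) / 2]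

/-- The unit conormal `dx`. -/
def normalTab : Fin 4 → ℝ := ![1, 0, 0, 0]

/-- The Riemann tensor `R^a_{bcd}` of the Petrov metric. -/
def riemannTab (p : Pt) (a b c d : Fin 4) : ℝ :=
  normalTab a * (normalTab c * tidalLowTab p b d - normalTab d * tidalLowTab p b c)
    - normalTab b * (normalTab c * tidalTab a d - normalTab d * tidalTab a c)
    - (shapeTab a c * metricTab' p b d - shapeTab a d * metricTab' p b c) / 2

theorem riemannTab_swap (p : Pt) (a b c d : Fin 4) :
    riemannTab p a b d c = -riemannTab p a b c d := by
  unfold riemannTab; ring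

theorem riemann_swap (g : MetricField) (p : Pt) (a b c d : Fin 4) :
    riemann g a b d c p = -riemann g a b c d p := by
  unfold riemann
  rw [neg_add, neg_sub, ← Finset.sum_neg_distrib]
  congr 1
  exact Finset.sum_congr rfl fun e _ => by ring

set_option maxHeartbeats 1000000 in
theorem riemann_eq {k : ℝ} (hk : k ≠ 0) (a b c d : Fin 4) (p : Pt) :
    riemann (petrovMetric k) a b c d p = riemannTab p a b c d := by
  have h3 := sqrt_three_sq
  -- Both sides are antisymmetric in the last two indices, so six index pairs suffice.
  wlog hcd : c < d generalizing c d
  · rcases lt_or_eq_of_le (not_lt.1 hcd) with h | h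
    · rw [riemann_swap, riemannTab_swap, this d c h]
    · subst h
      have h1 := riemann_swap (petrovMetric k) p a b d d
      have h2 := riemannTab_swap p a b d d
      linarith
  unfold riemann
  simp only [pd_christoffel hk, christoffel_eq hk, Fin.sum_univ_four, riemannTab]
  fin_cases c <;> fin_cases d <;>
  first
  | exact absurd hcd (by decide)
  | skip
  all_goals
    clear hcd
    fin_cases a <;> fin_cases b <;>
    simp [christoffelTab, christoffelTab', metricTab', shapeTab, tidalTab, tidalLowTab, normalTab]
  all_goals try ring_nf
  all_goals try simp only [h3]
  all_goals try ring_nf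

/-- The component check reflects `R_xx = -tr K²` and `R_ij = -(tr K) K_ij` on the slices, where the
tidal term `-K²` cancels the quadratic term of the Gauss equation. Both traces vanish because the
eigenvalues of `K` are the cube roots of `-1`. -/
theorem ricci_eq_zero {k : ℝ} (hk : k ≠ 0) (b d : Fin 4) (p : Pt) :
    ricci (petrovMetric k) b d p = 0 := by
  unfold ricci
  simp only [riemann_eq hk, Fin.sum_univ_four]
  fin_cases b <;> fin_cases d <;>
    simp [riemannTab, metricTab', shapeTab, tidalTab, tidalLowTab, normalTab] <;>
    first
    | done
    | ring1
    | linear_combination fC p / 4 * sqrt_three_sq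
    | linear_combination -fC p / 4 * sqrt_three_sq
    | linear_combination fS p / 4 * sqrt_three_sq

/-- The Weyl tensor of the Petrov metric, up to the factor `k⁻²`. -/
def weylTab (p : Pt) (a b c d : Fin 4) : ℝ :=
  normalTab a * (normalTab c * tidalLowTab p b d - normalTab d * tidalLowTab p b c)
    - normalTab b * (normalTab c * tidalLowTab p a d - normalTab d * tidalLowTab p a c)
    - (metricTab' p a c * metricTab' p b d - metricTab' p a d * metricTab' p b c) / 4

theorem sum_metricTab_mul_normalTab (p : Pt) (a : Fin 4) :
    ∑ e, metricTab p a e * normalTab e = normalTab a := by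
  fin_cases a <;> simp [Fin.sum_univ_four, metricTab, normalTab]

theorem sum_metricTab_mul_tidalTab (p : Pt) (a b : Fin 4) :
    ∑ e, metricTab p a e * tidalTab e b = tidalLowTab p a b := by
  fin_cases a <;> fin_cases b <;>
    simp [Fin.sum_univ_four, metricTab, tidalTab, tidalLowTab] <;> ring

theorem sum_metricTab_mul_shapeTab (p : Pt) (a b : Fin 4) :
    ∑ e, metricTab p a e * shapeTab e b = metricTab' p a b / 2 := by
  fin_cases a <;> fin_cases b <;>
    simp [Fin.sum_univ_four, metricTab, shapeTab, metricTab'] <;> ring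

theorem riemannLow_eq {k : ℝ} (hk : k ≠ 0) (a b c d : Fin 4) (p : Pt) :
    riemannLow (petrovMetric k) a b c d p = (k ^ 2)⁻¹ * weylTab p a b c d := by
  have h : ∀ e, petrovMetric k p a e * riemannTab p e b c d = (k ^ 2)⁻¹ *
      (metricTab p a e * normalTab e
          * (normalTab c * tidalLowTab p b d - normalTab d * tidalLowTab p b c)
        - normalTab b * (normalTab c * (metricTab p a e * tidalTab e d)
          - normalTab d * (metricTab p a e * tidalTab e c))
        - (metricTab p a e * shapeTab e c * metricTab' p b d
          - metricTab p a e * shapeTab e d * metricTab' p b c) / 2) := fun e => by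
    rw [petrovMetric_apply, riemannTab]; ring
  unfold riemannLow
  simp only [riemann_eq hk, h, ← Finset.mul_sum, Finset.sum_sub_distrib, ← Finset.sum_mul,
    ← Finset.sum_div, sum_metricTab_mul_normalTab, sum_metricTab_mul_tidalTab,
    sum_metricTab_mul_shapeTab, weylTab]
  ring

theorem weyl_eq {k : ℝ} (hk : k ≠ 0) (a b c d : Fin 4) (p : Pt) :
    weyl (petrovMetric k) a b c d p = (k ^ 2)⁻¹ * weylTab p a b c d := by
  simp [weyl, scalarCurv, ricci_eq_zero hk, riemannLow_eq hk]

/-! ### Hodge duality and the self-dual Weyl operator -/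

/-- An antisymmetric 2-tensor with both indices raised, up to the factor `k⁴`. -/
def raiseTab (p : Pt) (F : Fin 4 → Fin 4 → ℂ) : Matrix (Fin 4) (Fin 4) ℂ :=
  !![0, (fC p ^ 2 + fS p ^ 2) * F 0 1, fA p * (fC p * F 0 2 - fS p * F 0 3),
      -(fA p * (fS p * F 0 2 + fC p * F 0 3));
     -((fC p ^ 2 + fS p ^ 2) * F 0 1), 0, fC p * F 1 2 - fS p * F 1 3,
      -(fS p * F 1 2 + fC p * F 1 3);
     -(fA p * (fC p * F 0 2 - fS p * F 0 3)), -(fC p * F 1 2 - fS p * F 1 3), 0, -(fA p * F 2 3);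
     fA p * (fS p * F 0 2 + fC p * F 0 3), fS p * F 1 2 + fC p * F 1 3, fA p * F 2 3, 0]

theorem fA_mul_complex (p : Pt) : (fA p : ℂ) * ((fC p : ℂ) ^ 2 + (fS p : ℂ) ^ 2) = 1 := by
  exact_mod_cast fA_mul p

theorem raise_eq {k : ℝ} (hk : k ≠ 0) {F : TwoTensor} {p : Pt}
    (hF : ∀ a b, F p a b = -F p b a) (a b : Fin 4) :
    raise (petrovMetric k) F a b p = (k : ℂ) ^ 4 * raiseTab p (F p) a b := by
  have h := fA_mul_complex p
  have hd : ∀ a, F p a a = 0 := fun a => self_eq_neg.1 (hF a a)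
  unfold raise
  simp only [petrovMetric_inv hk, Matrix.smul_apply, smul_eq_mul]
  fin_cases a <;> fin_cases b <;>
    simp [Fin.sum_univ_four, invTab, raiseTab, hd, hF 1 0, hF 2 0, hF 3 0, hF 2 1, hF 3 1, hF 3 2]
  all_goals
    first
    | ring1
    | linear_combination ((k : ℂ) ^ 4 * (fC p * F p 1 2 - fS p * F p 1 3)) * h
    | linear_combination -((k : ℂ) ^ 4 * (fC p * F p 1 2 - fS p * F p 1 3)) * h
    | linear_combination ((k : ℂ) ^ 4 * (fS p * F p 1 2 + fC p * F p 1 3)) * h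
    | linear_combination -((k : ℂ) ^ 4 * (fS p * F p 1 2 + fC p * F p 1 3)) * h
    | linear_combination ((k : ℂ) ^ 4 * fA p * F p 2 3) * h
    | linear_combination -((k : ℂ) ^ 4 * fA p * F p 2 3) * h

theorem volForm_eq {k : ℝ} (σ : ℤˣ) (a b c d : Fin 4) (p : Pt) :
    volForm σ (petrovMetric k) a b c d p = ((σ : ℤ) : ℝ) * (k ^ 4)⁻¹ *
      ((((b : ℕ) : ℝ) - (a : ℕ)) * ((c : ℕ) - (a : ℕ)) * ((d : ℕ) - (a : ℕ)) *
        ((c : ℕ) - (b : ℕ)) * ((d : ℕ) - (b : ℕ)) * ((d : ℕ) - (c : ℕ)) / 12) := by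
  have : √|(petrovMetric k p).det| = (k ^ 4)⁻¹ := by
    rw [det_petrovMetric, abs_neg, abs_of_nonneg (by positivity),
      show ((k ^ 2)⁻¹) ^ 4 = ((k ^ 4)⁻¹) ^ 2 by rw [← inv_pow, ← inv_pow]; ring,
      Real.sqrt_sq (by positivity)]
  rw [volForm, this, leviCivita_eq]

/-- The Hodge dual of an antisymmetric 2-tensor. -/
def hodgeTab (σ : ℤˣ) (p : Pt) (F : Fin 4 → Fin 4 → ℂ) : Matrix (Fin 4) (Fin 4) ℂ :=
  ((σ : ℤ) : ℂ) •
  !![0, -(fA p * F 2 3), fS p * F 1 2 + fC p * F 1 3, fC p * F 1 2 - fS p * F 1 3;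
     fA p * F 2 3, 0, -(fA p * (fS p * F 0 2 + fC p * F 0 3)),
      -(fA p * (fC p * F 0 2 - fS p * F 0 3));
     -(fS p * F 1 2 + fC p * F 1 3), fA p * (fS p * F 0 2 + fC p * F 0 3), 0,
      (fC p ^ 2 + fS p ^ 2) * F 0 1;
     -(fC p * F 1 2 - fS p * F 1 3), fA p * (fC p * F 0 2 - fS p * F 0 3),
      -((fC p ^ 2 + fS p ^ 2) * F 0 1), 0]

/-- Duality of 2-forms in dimension four is conformally invariant: the factor `k⁻⁴` of the volume
form cancels the `k⁴` from raising two indices, so no `k` remains. -/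
theorem hodge_eq {k : ℝ} (hk : k ≠ 0) (σ : ℤˣ) {F : TwoTensor} {p : Pt}
    (hF : ∀ a b, F p a b = -F p b a) (a b : Fin 4) :
    hodge σ (petrovMetric k) F p a b = hodgeTab σ p (F p) a b := by
  have hk4 : (k : ℂ) ≠ 0 := by exact_mod_cast hk
  have key : hodge σ (petrovMetric k) F p a b = ((σ : ℤ) : ℂ) * (2⁻¹ * ∑ c : Fin 4, ∑ d : Fin 4,
      ((((b : ℕ) : ℂ) - (a : ℕ)) * ((c : ℕ) - (a : ℕ)) * ((d : ℕ) - (a : ℕ)) *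
        ((c : ℕ) - (b : ℕ)) * ((d : ℕ) - (b : ℕ)) * ((d : ℕ) - (c : ℕ)) / 12) *
        raiseTab p (F p) c d) := by
    simp only [hodge, volForm_eq, raise_eq hk hF, Finset.mul_sum]
    refine Finset.sum_congr rfl fun c _ => Finset.sum_congr rfl fun d _ => ?_
    push_cast
    field_simp
  rw [key, hodgeTab, Matrix.smul_apply, smul_eq_mul]
  congr 1
  fin_cases a <;> fin_cases b <;> simp [Fin.sum_univ_four, raiseTab] <;> ring

/-- The self-dual 2-form with components `F_{xy} = u`, `F_{xz} = v`, `F_{xt} = w`. -/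
def sdTab (σ : ℤˣ) (p : Pt) (u v w : ℂ) : Matrix (Fin 4) (Fin 4) ℂ :=
  !![0, u, v, w;
     -u, 0, Complex.I * (σ : ℤ) * fA p * (fS p * v + fC p * w),
      Complex.I * (σ : ℤ) * fA p * (fC p * v - fS p * w);
     -v, -(Complex.I * (σ : ℤ) * fA p * (fS p * v + fC p * w)), 0,
      -(Complex.I * (σ : ℤ) * (fC p ^ 2 + fS p ^ 2) * u);
     -w, -(Complex.I * (σ : ℤ) * fA p * (fC p * v - fS p * w)),
      Complex.I * (σ : ℤ) * (fC p ^ 2 + fS p ^ 2) * u, 0]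

theorem units_sq_complex (σ : ℤˣ) : ((σ : ℤ) : ℂ) ^ 2 = 1 := by
  rcases Int.units_eq_one_or σ with h | h <;> simp [h]

theorem sdTab_antisymm (σ : ℤˣ) (p : Pt) (u v w : ℂ) (a b : Fin 4) :
    sdTab σ p u v w a b = -sdTab σ p u v w b a := by
  fin_cases a <;> fin_cases b <;> simp [sdTab]

theorem sdTab_smul (σ : ℤˣ) (p : Pt) (u v w c : ℂ) :
    sdTab σ p (c * u) (c * v) (c * w) = c • sdTab σ p u v w := by
  ext a b
  fin_cases a <;> fin_cases b <;> simp [sdTab] <;> ring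

theorem hodgeTab_sdTab (σ : ℤˣ) (p : Pt) (u v w : ℂ) :
    hodgeTab σ p (sdTab σ p u v w) = Complex.I • sdTab σ p u v w := by
  have h := fA_mul_complex p
  have hσ := units_sq_complex σ
  have hI := Complex.I_sq
  ext a b
  fin_cases a <;> fin_cases b <;> simp [sdTab, hodgeTab]
  · linear_combination (Complex.I * u * ((σ : ℤ) : ℂ) ^ 2) * h + Complex.I * u * hσ
  · linear_combination (Complex.I * v * ((σ : ℤ) : ℂ) ^ 2) * h + Complex.I * v * hσ
  · linear_combination (Complex.I * w * ((σ : ℤ) : ℂ) ^ 2) * h + Complex.I * w * hσ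
  · linear_combination (Complex.I * u * ((σ : ℤ) : ℂ) ^ 2) * h + Complex.I * u * hσ
  · linear_combination -(((σ : ℤ) : ℂ) * fA p * (fS p * v + fC p * w)) * hI
  · linear_combination -(((σ : ℤ) : ℂ) * fA p * (fC p * v - fS p * w)) * hI
  · linear_combination -(Complex.I * v * ((σ : ℤ) : ℂ) ^ 2) * h - Complex.I * v * hσ
  · linear_combination (((σ : ℤ) : ℂ) * fA p * (fS p * v + fC p * w)) * hI
  · linear_combination (((σ : ℤ) : ℂ) * (fC p ^ 2 + fS p ^ 2) * u) * hI
  · linear_combination -(Complex.I * w * ((σ : ℤ) : ℂ) ^ 2) * h - Complex.I * w * hσ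
  · linear_combination (((σ : ℤ) : ℂ) * fA p * (fC p * v - fS p * w)) * hI
  · linear_combination -(((σ : ℤ) : ℂ) * (fC p ^ 2 + fS p ^ 2) * u) * hI

/-- Three components of `*F = iF`, namely `yz`, `yt` and `zt`, already solve for the components
without an index `x` in terms of `F_xy`, `F_xz`, `F_xt`. -/
theorem eq_sdTab {k : ℝ} (hk : k ≠ 0) {σ : ℤˣ} {F : TwoTensor} {p : Pt}
    (hF : ∀ a b, F p a b = -F p b a) (hs : hodge σ (petrovMetric k) F p = Complex.I • F p) :
    F p = sdTab σ p (F p 0 1) (F p 0 2) (F p 0 3) := by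
  have hI := Complex.I_sq
  have hd : ∀ a, F p a a = 0 := fun a => self_eq_neg.1 (hF a a)
  have h : ∀ a b, hodgeTab σ p (F p) a b = Complex.I * F p a b := fun a b => by
    rw [← hodge_eq hk σ hF, hs]; rfl
  have h12 := h 1 2
  have h13 := h 1 3
  have h23 := h 2 3
  simp [hodgeTab] at h12 h13 h23
  have e12 : F p 1 2 = Complex.I * (σ : ℤ) * fA p * (fS p * F p 0 2 + fC p * F p 0 3) := by
    linear_combination F p 1 2 * hI + Complex.I * h12
  have e13 : F p 1 3 = Complex.I * (σ : ℤ) * fA p * (fC p * F p 0 2 - fS p * F p 0 3) := by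
    linear_combination F p 1 3 * hI + Complex.I * h13
  have e23 : F p 2 3 = -(Complex.I * (σ : ℤ) * (fC p ^ 2 + fS p ^ 2) * F p 0 1) := by
    linear_combination F p 2 3 * hI + Complex.I * h23
  ext a b
  fin_cases a <;> fin_cases b <;> simp [sdTab]
  exacts [hd 0, hF 1 0, hd 1, e12, e13, hF 2 0, by rw [hF, e12], hd 2, e23, hF 3 0,
    by rw [hF, e13], by rw [hF, e23]; ring, hd 3]

theorem hodge_of_eq_sdTab {k : ℝ} (hk : k ≠ 0) {σ : ℤˣ} {F : TwoTensor} {p : Pt} {u v w : ℂ}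
    (hF : F p = sdTab σ p u v w) : hodge σ (petrovMetric k) F p = Complex.I • F p := by
  funext a b
  rw [hodge_eq hk σ (fun a b => by rw [hF]; exact sdTab_antisymm σ p u v w a b), hF,
    hodgeTab_sdTab]
  rfl

/-- The contraction of the Weyl tensor with a 2-form. -/
def weylContract (g : MetricField) (F : TwoTensor) : TwoTensor := fun p a b =>
  2⁻¹ * ∑ c, ∑ d, (weyl g a b c d p : ℂ) * raise g F c d p

/-- The Hodge dual at a point is a linear combination of the components at that point. -/
theorem exists_hodge_eq_sum (σ : ℤˣ) (g : MetricField) (p : Pt) (a b : Fin 4) :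
    ∃ L : Fin 4 × Fin 4 → ℂ, ∀ F : TwoTensor,
      hodge σ g F p a b = ∑ x, L x * F p x.1 x.2 := by
  refine ⟨fun x => ∑ y : Fin 4 × Fin 4, 2⁻¹ * ((volForm σ g a b y.1 y.2 p : ℂ) *
    (((g p)⁻¹ y.1 x.1 * (g p)⁻¹ y.2 x.2 : ℝ) : ℂ)), fun F => ?_⟩
  have h1 : hodge σ g F p a b = ∑ y : Fin 4 × Fin 4, ∑ x : Fin 4 × Fin 4,
      2⁻¹ * ((volForm σ g a b y.1 y.2 p : ℂ) *
        (((g p)⁻¹ y.1 x.1 * (g p)⁻¹ y.2 x.2 : ℝ) : ℂ)) * F p x.1 x.2 := by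
    simp only [hodge, raise, Fintype.sum_prod_type, Finset.mul_sum]
    refine Finset.sum_congr rfl fun c _ => Finset.sum_congr rfl fun d _ =>
      Finset.sum_congr rfl fun m _ => Finset.sum_congr rfl fun n _ => ?_
    ring
  rw [h1, Finset.sum_comm]
  exact Finset.sum_congr rfl fun x _ => (Finset.sum_mul _ _ _).symm

/-- The dual acts on the first index pair and is linear in the components, so it commutes with
contraction over the second pair. Hence `𝒲 = ½(1 - i*) ∘ W` as operators. -/
theorem weylMap_eq (σ : ℤˣ) (g : MetricField) (F : TwoTensor) (p : Pt) (a b : Fin 4) :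
    weylMap σ g F p a b =
      2⁻¹ * (weylContract g F p a b - Complex.I * hodge σ g (weylContract g F) p a b) := by
  have h : hodge σ g (weylContract g F) p a b = 2⁻¹ * ∑ c, ∑ d,
      hodge σ g (fun q m n => (weyl g m n c d q : ℂ)) p a b * raise g F c d p := by
    obtain ⟨L, hL⟩ := exists_hodge_eq_sum σ g p a b
    simp only [hL, weylContract, Finset.mul_sum, Finset.sum_mul]
    rw [Finset.sum_comm]
    refine Finset.sum_congr rfl fun c _ => ?_
    rw [Finset.sum_comm]
    refine Finset.sum_congr rfl fun d _ => Finset.sum_congr rfl fun x _ => ?_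
    ring
  rw [h]
  unfold weylMap selfDualWeyl weylContract
  simp only [Finset.mul_sum, ← Finset.sum_sub_distrib]
  refine Finset.sum_congr rfl fun c _ => Finset.sum_congr rfl fun d _ => ?_
  ring

theorem raiseTab_sdTab (σ : ℤˣ) (p : Pt) (u v w : ℂ) :
    raiseTab p (sdTab σ p u v w) =
      !![0, (fC p ^ 2 + fS p ^ 2) * u, fA p * (fC p * v - fS p * w), -(fA p * (fS p * v + fC p * w));
        -((fC p ^ 2 + fS p ^ 2) * u), 0, Complex.I * (σ : ℤ) * w, -(Complex.I * (σ : ℤ) * v);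
        -(fA p * (fC p * v - fS p * w)), -(Complex.I * (σ : ℤ) * w), 0, Complex.I * (σ : ℤ) * u;
        fA p * (fS p * v + fC p * w), Complex.I * (σ : ℤ) * v, -(Complex.I * (σ : ℤ) * u), 0] := by
  have h := fA_mul_complex p
  ext a b
  fin_cases a <;> fin_cases b <;> simp [sdTab, raiseTab]
  · linear_combination (Complex.I * (σ : ℤ) * w) * h
  · linear_combination -(Complex.I * (σ : ℤ) * v) * h
  · linear_combination -(Complex.I * (σ : ℤ) * w) * h
  · linear_combination (Complex.I * (σ : ℤ) * u) * h
  · linear_combination (Complex.I * (σ : ℤ) * v) * h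
  · linear_combination (Complex.I * (σ : ℤ) * u) * h

/-- On the triple `(F_xy, F_xz, F_xt)` the Weyl tensor acts through its electric part, as the
transpose of `tidalTab`. In particular the image of a self-dual form is self-dual. -/
theorem weylContract_sdTab {k : ℝ} (hk : k ≠ 0) {σ : ℤˣ} {F : TwoTensor} {p : Pt} {u v w : ℂ}
    (hF : F p = sdTab σ p u v w) :
    weylContract (petrovMetric k) F p = (k : ℂ) ^ 2 •
      sdTab σ p (-u) ((v - √3 * w) / 2) ((√3 * v + w) / 2) := by
  have h := fA_mul_complex p
  have hk' : (k : ℂ) ≠ 0 := by exact_mod_cast hk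
  have h3 : ((√3 : ℝ) : ℂ) ^ 2 = 3 := by exact_mod_cast sqrt_three_sq
  have hanti : ∀ a b, F p a b = -F p b a := fun a b => by
    rw [hF]; exact sdTab_antisymm σ p u v w a b
  funext a b
  have key : weylContract (petrovMetric k) F p a b = (k : ℂ) ^ 2 * (2⁻¹ * ∑ c, ∑ d,
      (weylTab p a b c d : ℂ) * raiseTab p (sdTab σ p u v w) c d) := by
    simp only [weylContract, weyl_eq hk, raise_eq hk hanti, Finset.mul_sum, hF]
    refine Finset.sum_congr rfl fun c _ => Finset.sum_congr rfl fun d _ => ?_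
    push_cast
    field_simp
  rw [key, raiseTab_sdTab]
  erw [Matrix.smul_apply]
  rw [smul_eq_mul]
  congr 1
  fin_cases a <;> fin_cases b <;>
    simp [Fin.sum_univ_four, weylTab, sdTab, normalTab, tidalLowTab, metricTab']
  all_goals
    first
    | ring1
    | linear_combination u * h
    | linear_combination -u * h
    | linear_combination ((v - √3 * w) / 2) * h
    | linear_combination -((v - √3 * w) / 2) * h
    | linear_combination ((√3 * v + w) / 2) * h
    | linear_combination -((√3 * v + w) / 2) * h
    | linear_combination (Complex.I * (σ : ℤ) * u * (fC p ^ 2 + fS p ^ 2) / 4) * h3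
    | linear_combination -(Complex.I * (σ : ℤ) * u * (fC p ^ 2 + fS p ^ 2) / 4) * h3

/-- The contraction is already self-dual, and `½(1 - i*)` is the identity on self-dual forms. -/
theorem weylMap_sdTab {k : ℝ} (hk : k ≠ 0) {σ : ℤˣ} {F : TwoTensor} {p : Pt} {u v w : ℂ}
    (hF : F p = sdTab σ p u v w) :
    weylMap σ (petrovMetric k) F p = (k : ℂ) ^ 2 •
      sdTab σ p (-u) ((v - √3 * w) / 2) ((√3 * v + w) / 2) := by
  have h := weylContract_sdTab hk hF
  have h2 := hodge_of_eq_sdTab hk (σ := σ) (h.trans (sdTab_smul _ _ _ _ _ _).symm)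
  funext a b
  rw [weylMap_eq, h2, Pi.smul_apply, Pi.smul_apply, smul_eq_mul, ← h]
  linear_combination (-1 / 2 * weylContract (petrovMetric k) F p a b) * Complex.I_sq

theorem sqrt_three_sq_complex : ((√3 : ℝ) : ℂ) ^ 2 = 3 := by exact_mod_cast sqrt_three_sq

theorem sqrt_three_ne_zero_complex : ((√3 : ℝ) : ℂ) ≠ 0 := fun h => by
  have := sqrt_three_sq_complex
  rw [h] at this
  norm_num at this

/-! ### Eigenbivectors -/

/-- The eigenvectors of the self-dual Weyl tensor. -/
theorem eigenvector_cases {k : ℝ} (hk : k ≠ 0) {α u v w : ℂ} (h0 : u ≠ 0 ∨ v ≠ 0 ∨ w ≠ 0)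
    (hu : (k : ℂ) ^ 2 * -u = α * u) (hv : (k : ℂ) ^ 2 * ((v - √3 * w) / 2) = α * v)
    (hw : (k : ℂ) ^ 2 * ((√3 * v + w) / 2) = α * w) :
    (α = -(k : ℂ) ^ 2 ∧ v = 0 ∧ w = 0 ∧ u ≠ 0) ∨
      ∃ τ : ℤˣ, α = (k : ℂ) ^ 2 * ((1 - Complex.I * (τ : ℤ) * √3) / 2) ∧ u = 0 ∧
        w = Complex.I * (τ : ℤ) * v ∧ v ≠ 0 := by
  have hk2 : (k : ℂ) ^ 2 ≠ 0 := by exact_mod_cast pow_ne_zero 2 hk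
  have h3 := sqrt_three_sq_complex
  have h3' := sqrt_three_ne_zero_complex
  by_cases hu0 : u = 0
  · right
    -- Eliminating `α` between the last two equations leaves `k²√3 (v² + w²) = 0`, which factors
    -- over `ℂ`.
    have hsq : (k : ℂ) ^ 2 * √3 * ((w - Complex.I * v) * (w + Complex.I * v)) = 0 := by
      linear_combination (-2 * w) * hv + (2 * v) * hw - (k : ℂ) ^ 2 * √3 * v ^ 2 * Complex.I_sq
    have hsq' := (mul_eq_zero.1 hsq).resolve_left (mul_ne_zero hk2 h3')
    have aux : ∀ τ : ℤˣ, w = Complex.I * (τ : ℤ) * v → ∃ τ : ℤˣ,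
        α = (k : ℂ) ^ 2 * ((1 - Complex.I * (τ : ℤ) * √3) / 2) ∧ u = 0 ∧
        w = Complex.I * (τ : ℤ) * v ∧ v ≠ 0 := by
      intro τ hτ
      have hv0 : v ≠ 0 := by
        rintro rfl
        simp_all
      refine ⟨τ, mul_right_cancel₀ hv0 ?_, hu0, hτ, hv0⟩
      rw [← hv, hτ]
      ring
    rcases mul_eq_zero.1 hsq' with h | h
    · exact aux 1 (by push_cast; linear_combination h)
    · exact aux (-1) (by push_cast; linear_combination h)
  · left
    have hα : α = -(k : ℂ) ^ 2 := mul_right_cancel₀ hu0 (by rw [← hu]; ring)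
    subst hα
    have e1 : (k : ℂ) ^ 2 * √3 * w = 0 := by
      linear_combination √3 / 2 * hw - 1 / 2 * hv - (k : ℂ) ^ 2 * v / 4 * h3
    have hw0 : w = 0 := (mul_eq_zero.1 e1).resolve_left (mul_ne_zero hk2 h3')
    have e2 : (k : ℂ) ^ 2 * v = 0 := by
      rw [hw0] at hv
      linear_combination 2 / 3 * hv
    exact ⟨rfl, (mul_eq_zero.1 e2).resolve_left hk2, hw0, hu0⟩

/-- A continuous eigenvector field of the self-dual Weyl tensor on a connected set belongs to a
constant eigenvalue. -/
theorem eigenvector_cases_on {k : ℝ} (hk : k ≠ 0) {U : Set Pt} (hU : IsPreconnected U)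
    {α u v w : Pt → ℂ} (cu : ContinuousOn u U) (cv : ContinuousOn v U) (cw : ContinuousOn w U)
    (h0 : ∀ p ∈ U, u p ≠ 0 ∨ v p ≠ 0 ∨ w p ≠ 0)
    (hu : ∀ p ∈ U, (k : ℂ) ^ 2 * -u p = α p * u p)
    (hv : ∀ p ∈ U, (k : ℂ) ^ 2 * ((v p - √3 * w p) / 2) = α p * v p)
    (hw : ∀ p ∈ U, (k : ℂ) ^ 2 * ((√3 * v p + w p) / 2) = α p * w p) :
    (∀ p ∈ U, α p = -(k : ℂ) ^ 2 ∧ v p = 0 ∧ w p = 0 ∧ u p ≠ 0) ∨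
      ∃ τ : ℤˣ, ∀ p ∈ U, α p = (k : ℂ) ^ 2 * ((1 - Complex.I * (τ : ℤ) * √3) / 2) ∧ u p = 0 ∧
        w p = Complex.I * (τ : ℤ) * v p ∧ v p ≠ 0 := by
  have key := fun p hp => eigenvector_cases hk (h0 p hp) (hu p hp) (hv p hp) (hw p hp)
  have hne : ∀ p ∈ U, u p + v p ≠ 0 := fun p hp => by
    rcases key p hp with ⟨-, h1, -, h2⟩ | ⟨τ, -, h1, -, h2⟩ <;> simpa [h1] using h2
  -- The ratio `w / (u + v)` labels the type: it is `0` for the real eigenvalue and `iτ` for the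
  -- others. The denominator never vanishes on eigenvectors, so the ratio is continuous with values
  -- in a finite set, hence constant on a preconnected set.
  let T : Set ℂ := {0, Complex.I, -Complex.I}
  have hfin : T.Finite := by simp [T]
  have hcont : ContinuousOn (fun p => w p / (u p + v p)) U := cw.div (cu.add cv) hne
  have hmaps : Set.MapsTo (fun p => w p / (u p + v p)) U T := fun p hp => by
    rcases key p hp with ⟨-, -, h1, -⟩ | ⟨τ, -, h1, h2, h3⟩
    · simp [T, h1]
    · rcases Int.units_eq_one_or τ with h | h <;> simp [T, h1, h2, h, h3, neg_div]
  have hconst := fun p hp q hq => hU.constant_of_mapsTo hfin.isDiscrete hcont hmaps (x := p) (y := q) hp hq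
  have hval : ∀ p ∈ U, ∀ τ : ℤˣ, u p = 0 → w p = Complex.I * (τ : ℤ) * v p → v p ≠ 0 →
      w p / (u p + v p) = Complex.I * (τ : ℤ) := fun p hp τ h1 h2 h3 => by
    rw [h1, h2, zero_add, mul_div_cancel_right₀ _ h3]
  have hinj : ∀ τ τ' : ℤˣ, Complex.I * (τ : ℤ) = Complex.I * (τ' : ℤ) → τ = τ' := fun τ τ' h => by
    have := mul_left_cancel₀ Complex.I_ne_zero h
    exact Units.ext (by exact_mod_cast this)
  by_cases hex : ∃ p ∈ U, u p = 0
  · obtain ⟨p, hp, hup⟩ := hex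
    rcases key p hp with ⟨-, -, -, h1⟩ | ⟨τ, -, h1, h2, h3⟩
    · exact absurd hup h1
    · refine Or.inr ⟨τ, fun q hq => ?_⟩
      have h4 := hconst p hp q hq
      simp only [hval p hp τ h1 h2 h3] at h4
      rcases key q hq with ⟨-, -, h5, -⟩ | ⟨τ', h5, h6, h7, h8⟩
      · rw [h5, zero_div] at h4
        rcases Int.units_eq_one_or τ with h | h <;> simp [h] at h4
      · rw [hval q hq τ' h6 h7 h8] at h4
        have := hinj _ _ h4
        subst this
        exact ⟨h5, h6, h7, h8⟩
  · refine Or.inl fun p hp => ?_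
    rcases key p hp with h | ⟨τ, -, h1, -⟩
    · exact h
    · exact absurd ⟨p, hp, h1⟩ hex

/-- The alternatives for a self-dual eigenbivector field on a connected set. -/
theorem eigenbivector_cases {k : ℝ} (hk : k ≠ 0) {σ : ℤˣ} {U : Set Pt} (hU : IsPreconnected U)
    {F : TwoTensor} {α : Pt → ℂ} (hF : ContDiffOn ℝ ∞ F U) (h0 : ∀ p ∈ U, F p ≠ 0)
    (hs : ∀ p ∈ U, F p = sdTab σ p (F p 0 1) (F p 0 2) (F p 0 3))
    (hα : ∀ p ∈ U, weylMap σ (petrovMetric k) F p = α p • F p) :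
    (∀ p ∈ U, α p = -(k : ℂ) ^ 2 ∧ F p 0 2 = 0 ∧ F p 0 3 = 0 ∧ F p 0 1 ≠ 0) ∨
      ∃ τ : ℤˣ, ∀ p ∈ U, α p = (k : ℂ) ^ 2 * ((1 - Complex.I * (τ : ℤ) * √3) / 2) ∧
        F p 0 1 = 0 ∧ F p 0 3 = Complex.I * (τ : ℤ) * F p 0 2 ∧ F p 0 2 ≠ 0 := by
  have hc : ∀ a b, ContinuousOn (fun p => F p a b) U := fun a b =>
    (continuous_apply_apply a b).comp_continuousOn hF.continuousOn
  have he : ∀ p ∈ U, ∀ a b, (k : ℂ) ^ 2 * sdTab σ p (-F p 0 1) ((F p 0 2 - √3 * F p 0 3) / 2)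
      ((√3 * F p 0 2 + F p 0 3) / 2) a b = α p * F p a b := fun p hp a b => by
    have h1 := weylMap_sdTab hk (hs p hp)
    rw [hα p hp] at h1
    exact (congrFun (congrFun h1 a) b).symm
  refine eigenvector_cases_on hk hU (hc 0 1) (hc 0 2) (hc 0 3) ?_ (fun p hp => he p hp 0 1)
    (fun p hp => he p hp 0 2) (fun p hp => he p hp 0 3)
  intro p hp
  by_contra! h
  refine h0 p hp ?_
  rw [hs p hp, h.1, h.2.1, h.2.2]
  funext a b
  fin_cases a <;> fin_cases b <;> simp [sdTab]

/-! ### Smoothness and the calculus of partial derivatives -/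

theorem contDiff_fA : ContDiff ℝ ∞ fA := by unfold fA; fun_prop

theorem contDiff_fC : ContDiff ℝ ∞ fC := by unfold fC; fun_prop

theorem contDiff_fS : ContDiff ℝ ∞ fS := by unfold fS; fun_prop

theorem contDiff_petrovMetric (k : ℝ) (a b : Fin 4) :
    ContDiff ℝ ∞ (fun q => petrovMetric k q a b) := by
  have hA := contDiff_fA
  have hC := contDiff_fC
  have hS := contDiff_fS
  simp only [petrovMetric_apply]
  refine contDiff_const.mul ?_
  fin_cases a <;> fin_cases b <;> simp [metricTab] <;> fun_prop

theorem differentiable_christoffel {k : ℝ} (hk : k ≠ 0) (c a b : Fin 4) :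
    Differentiable ℝ (christoffel (petrovMetric k) c a b) := by
  have hA := contDiff_fA.differentiable (by simp)
  have hC := contDiff_fC.differentiable (by simp)
  have hS := contDiff_fS.differentiable (by simp)
  rw [show christoffel (petrovMetric k) c a b = fun q => christoffelTab q c a b from
    funext fun q => christoffel_eq hk c a b q]
  fin_cases c <;> fin_cases a <;> fin_cases b <;> simp [christoffelTab] <;> fun_prop

theorem christoffelTab_symm (p : Pt) (c a b : Fin 4) :
    christoffelTab p c a b = christoffelTab p c b a := by
  fin_cases c <;> fin_cases a <;> fin_cases b <;> simp [christoffelTab]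

section

variable {F : Type*} [NormedAddCommGroup F] [NormedSpace ℝ F]

theorem pd_congr {f f' : Pt → F} {p : Pt} (h : f =ᶠ[𝓝 p] f') (c : Fin 4) :
    pd c f p = pd c f' p := by
  unfold pd; rw [h.fderiv_eq]

theorem pd_eq_zero_of_eqOn {U : Set Pt} (hU : IsOpen U) {f : Pt → F} (h : ∀ p ∈ U, f p = 0)
    {p : Pt} (hp : p ∈ U) (c : Fin 4) : pd c f p = 0 := by
  have : f =ᶠ[𝓝 p] fun _ => 0 := Filter.eventually_of_mem (hU.mem_nhds hp) h
  rw [pd_congr this, pd, fderiv_fun_const]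
  simp

theorem pd_add {f f' : Pt → F} {p : Pt} (hf : DifferentiableAt ℝ f p)
    (hf' : DifferentiableAt ℝ f' p) (c : Fin 4) :
    pd c (fun q => f q + f' q) p = pd c f p + pd c f' p := by
  unfold pd; rw [fderiv_fun_add hf hf']; rfl

theorem pd_sub {f f' : Pt → F} {p : Pt} (hf : DifferentiableAt ℝ f p)
    (hf' : DifferentiableAt ℝ f' p) (c : Fin 4) :
    pd c (fun q => f q - f' q) p = pd c f p - pd c f' p := by
  unfold pd; rw [fderiv_fun_sub hf hf']; rfl

theorem pd_sum {f : Fin 4 → Pt → F} {p : Pt} (hf : ∀ i, DifferentiableAt ℝ (f i) p) (c : Fin 4) :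
    pd c (fun q => ∑ i, f i q) p = ∑ i, pd c (f i) p := by
  unfold pd
  rw [fderiv_fun_sum fun i _ => hf i]
  simp

theorem pd_mul {A : Type*} [NormedCommRing A] [NormedAlgebra ℝ A] {f f' : Pt → A} {p : Pt}
    (hf : DifferentiableAt ℝ f p) (hf' : DifferentiableAt ℝ f' p) (c : Fin 4) :
    pd c (fun q => f q * f' q) p = pd c f p * f' p + f p * pd c f' p := by
  unfold pd
  rw [fderiv_fun_mul hf hf']
  simp [mul_comm, add_comm]

theorem pd_const_mul {A : Type*} [NormedCommRing A] [NormedAlgebra ℝ A] {f : Pt → A} {p : Pt}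
    (hf : DifferentiableAt ℝ f p) (z : A) (c : Fin 4) :
    pd c (fun q => z * f q) p = z * pd c f p := by
  rw [pd_mul (differentiableAt_const z) hf]
  simp [pd]

theorem contDiffOn_pd {U : Set Pt} (hU : IsOpen U) {f : Pt → F} (hf : ContDiffOn ℝ ∞ f U)
    (c : Fin 4) : ContDiffOn ℝ ∞ (pd c f) U :=
  (hf.fderiv_of_isOpen hU (by simp)).clm_apply contDiffOn_const

theorem pd_pd_comm {U : Set Pt} (hU : IsOpen U) {f : Pt → F} (hf : ContDiffOn ℝ ∞ f U)
    {p : Pt} (hp : p ∈ U) (a c : Fin 4) : pd a (pd c f) p = pd c (pd a f) p := by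
  have hd : DifferentiableAt ℝ (fderiv ℝ f) p :=
    ((hf.fderiv_of_isOpen hU (m := ∞) (by simp)).contDiffAt (hU.mem_nhds hp)).differentiableAt
      (by simp)
  have h : ∀ a c : Fin 4, pd a (pd c f) p =
      fderiv ℝ (fderiv ℝ f) p (Pi.single a 1) (Pi.single c 1) := fun a c => by
    unfold pd
    rw [fderiv_clm_apply hd (differentiableAt_const _)]
    simp
  rw [h, h]
  exact ((hf.contDiffAt (hU.mem_nhds hp)).isSymmSndFDerivAt
    (by simp only [minSmoothness_of_isRCLikeNormedField]; exact ENat.LEInfty.out)).eq _ _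

end

theorem contDiffOn_flat (k : ℝ) {U : Set Pt} {ξ : Pt → Pt} (hξ : ContDiffOn ℝ ∞ ξ U) (a : Fin 4) :
    ContDiffOn ℝ ∞ (flat (petrovMetric k) ξ a) U := by
  unfold flat
  refine ContDiffOn.sum fun b _ => (contDiff_petrovMetric k a b).contDiffOn.mul ?_
  exact (contDiff_apply ℝ ℝ b).comp_contDiffOn hξ

/-! ### Killing fields and their Papapetrou fields -/

/-- The second derivatives of a Killing field are determined by its first derivatives and the
curvature. -/
theorem pd_papapetrou {k : ℝ} (hk : k ≠ 0) {U : Set Pt} (hU : IsOpen U) {ξ : Pt → Pt}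
    (hξ : IsKilling (petrovMetric k) U ξ) {p : Pt} (hp : p ∈ U) (c a b : Fin 4) :
    pd c (papapetrou (petrovMetric k) ξ a b) p =
      ∑ d, riemannTab p d c a b * flat (petrovMetric k) ξ d p
        + ∑ d, (christoffelTab p d c b * papapetrou (petrovMetric k) ξ a d p
          - christoffelTab p d c a * papapetrou (petrovMetric k) ξ b d p) := by
  set u := flat (petrovMetric k) ξ with hu
  set P := papapetrou (petrovMetric k) ξ with hP
  have su := contDiffOn_flat k hξ.1
  have du : ∀ d, DifferentiableAt ℝ (u d) p := fun d =>
    ((su d).contDiffAt (hU.mem_nhds hp)).differentiableAt (by simp)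
  have ddu : ∀ e d, DifferentiableAt ℝ (pd e (u d)) p := fun e d =>
    ((contDiffOn_pd hU (su d) e).contDiffAt (hU.mem_nhds hp)).differentiableAt (by simp)
  have hPdef : ∀ a b q, P a b q = pd a (u b) q - ∑ c, christoffelTab q c a b * u c q :=
    fun a b q => by simp [hP, papapetrou, christoffel_eq hk, hu]
  -- By the Killing equation, `s_ab = Γ^d_ab u_d` is the symmetric part of `∂_a u_b` on `U`, so the
  -- Papapetrou field is its antisymmetric part.
  let s : Fin 4 → Fin 4 → Pt → ℝ := fun a b q => ∑ d, christoffel (petrovMetric k) d a b q * u d q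
  have hs : ∀ a b, ∀ q ∈ U, s a b q = 2⁻¹ * (pd a (u b) q + pd b (u a) q) := by
    intro a b q hq
    have h1 := hξ.2 q hq a b
    have h2 : ∑ c, christoffelTab q c b a * u c q = s a b q := by
      refine Finset.sum_congr rfl fun d _ => ?_
      rw [christoffelTab_symm, christoffel_eq hk]
    have h3 : ∑ c, christoffelTab q c a b * u c q = s a b q := by
      refine Finset.sum_congr rfl fun d _ => ?_
      rw [christoffel_eq hk]
    change P a b q + P b a q = 0 at h1
    rw [hPdef, hPdef, h2, h3] at h1
    linarith
  have hPs : ∀ a b q, P a b q = pd a (u b) q - s a b q := fun a b q => by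
    rw [hPdef]
    simp only [s, christoffel_eq hk]
  have ps : ∀ e a b, pd e (s a b) p = 2⁻¹ * (pd e (pd a (u b)) p + pd e (pd b (u a)) p) := by
    intro e a b
    rw [pd_congr (Filter.eventually_of_mem (hU.mem_nhds hp) (hs a b)), pd_const_mul,
      pd_add (ddu a b) (ddu b a)]
    exact (ddu a b).add (ddu b a)
  have hPP : ∀ q ∈ U, P a b q = 2⁻¹ * (pd a (u b) q - pd b (u a) q) := fun q hq => by
    rw [hPs, hs a b q hq]; ring
  -- Commuting second derivatives gives `∂_c ∂_[a u_b] = ∂_a s_cb - ∂_b s_ca`. Only first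
  -- derivatives of `u` then remain, and differentiating `Γu` produces the curvature.
  have h1 : pd c (P a b) p = pd a (s c b) p - pd b (s c a) p := by
    rw [pd_congr (Filter.eventually_of_mem (hU.mem_nhds hp) hPP), pd_const_mul
      ((ddu a b).fun_sub (ddu b a)), pd_sub (ddu a b) (ddu b a), ps, ps, pd_pd_comm hU (su b) hp c a,
      pd_pd_comm hU (su a) hp c b, pd_pd_comm hU (su c) hp a b]
    ring
  have h2 : ∀ e a b, pd e (s a b) p = ∑ d, (pd e (christoffel (petrovMetric k) d a b) p * u d p
      + christoffelTab p d a b * (P e d p + ∑ f, christoffelTab p f e d * u f p)) := by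
    intro e a b
    have hd := fun d => (differentiable_christoffel hk d a b) p
    change pd e (fun q => ∑ d, christoffel (petrovMetric k) d a b q * u d q) p = _
    rw [pd_sum fun d => (hd d).fun_mul (du d)]
    refine Finset.sum_congr rfl fun d _ => ?_
    rw [pd_mul (hd d) (du d), christoffel_eq hk, hPdef]
    ring
  rw [h1, h2, h2]
  simp only [← riemann_eq hk, riemann, christoffel_eq hk]
  simp only [Fin.sum_univ_four, christoffelTab_symm p _ b, christoffelTab_symm p _ a]
  have h3 : ∀ e d a b, pd e (christoffel (petrovMetric k) d a b) p =
      pd e (christoffel (petrovMetric k) d b a) p := fun e d a b => by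
    congr 1
    funext q
    rw [christoffel_eq hk, christoffel_eq hk, christoffelTab_symm]
  simp only [h3 _ _ c]
  ring

theorem flat_eq (k : ℝ) (ξ : Pt → Pt) (p : Pt) :
    flat (petrovMetric k) ξ 0 p = (k ^ 2)⁻¹ * ξ p 0 ∧
    flat (petrovMetric k) ξ 1 p = (k ^ 2)⁻¹ * (fA p * ξ p 1) ∧
    flat (petrovMetric k) ξ 2 p = (k ^ 2)⁻¹ * (fC p * ξ p 2 - fS p * ξ p 3) ∧
    flat (petrovMetric k) ξ 3 p = -((k ^ 2)⁻¹ * (fS p * ξ p 2 + fC p * ξ p 3)) := by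
  simp only [flat, petrovMetric_apply, Fin.sum_univ_four]
  refine ⟨?_, ?_, ?_, ?_⟩ <;> simp [metricTab] <;> ring




/-- In the identity for `∂_x` of these two components all connection terms drop out. What is left is
the `zt` block of `tidalTab`, a rotation by 60 degrees, applied to `(ξ_z, ξ_t)`; the coefficients
below invert it. -/
theorem flat_eq_zero_of_papapetrou_xz_xt {k : ℝ} (hk : k ≠ 0) {U : Set Pt} (hU : IsOpen U)
    {ξ : Pt → Pt} (hξ : IsKilling (petrovMetric k) U ξ)
    (h02 : ∀ p ∈ U, papapetrou (petrovMetric k) ξ 0 2 p = 0)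
    (h03 : ∀ p ∈ U, papapetrou (petrovMetric k) ξ 0 3 p = 0) {p : Pt} (hp : p ∈ U) :
    flat (petrovMetric k) ξ 2 p = 0 ∧ flat (petrovMetric k) ξ 3 p = 0 := by
  have h3 := sqrt_three_sq
  have e1 := pd_papapetrou hk hU hξ hp 0 0 2
  have e2 := pd_papapetrou hk hU hξ hp 0 0 3
  rw [pd_eq_zero_of_eqOn hU h02 hp] at e1
  rw [pd_eq_zero_of_eqOn hU h03 hp] at e2
  simp [Fin.sum_univ_four, riemannTab, normalTab, tidalTab, tidalLowTab, shapeTab, metricTab',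
    christoffelTab, h02 p hp, h03 p hp] at e1 e2
  constructor
  · linear_combination 1 / 2 * e1 + √3 / 2 * e2 - flat (petrovMetric k) ξ 2 p / 4 * h3
  · linear_combination -√3 / 2 * e1 + 1 / 2 * e2 - flat (petrovMetric k) ξ 3 p / 4 * h3

theorem papapetrou_self_eq_zero {g : MetricField} {U : Set Pt} {ξ : Pt → Pt}
    (hξ : IsKilling g U ξ) {p : Pt} (hp : p ∈ U) (a : Fin 4) : papapetrou g ξ a a p = 0 := by
  linarith [hξ.2 p hp a a]

theorem papapetrou_swap {g : MetricField} {U : Set Pt} {ξ : Pt → Pt}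
    (hξ : IsKilling g U ξ) {p : Pt} (hp : p ∈ U) (a b : Fin 4) :
    papapetrou g ξ a b p = -papapetrou g ξ b a p := by
  linarith [hξ.2 p hp a b]

/-- The derivatives `∂_t` of `(∇ξ)_xz` and `∂_z` of `(∇ξ)_xt` contain the same multiple of `ξ_x`,
the tidal tensor being symmetric, but opposite multiples of `(∇ξ)_zt`. So `(∇ξ)_zt = 0`, and then
`ξ_x` is annihilated by both `fC` and `fS`, which have no common zero. -/
theorem flat_x_eq_zero {k : ℝ} (hk : k ≠ 0) {U : Set Pt} (hU : IsOpen U)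
    {ξ : Pt → Pt} (hξ : IsKilling (petrovMetric k) U ξ)
    (h02 : ∀ p ∈ U, papapetrou (petrovMetric k) ξ 0 2 p = 0)
    (h03 : ∀ p ∈ U, papapetrou (petrovMetric k) ξ 0 3 p = 0) {p : Pt} (hp : p ∈ U) :
    flat (petrovMetric k) ξ 0 p = 0 := by
  have h3 := sqrt_three_sq
  have h := fA_mul p
  have hd := papapetrou_self_eq_zero hξ hp
  have e1 := pd_papapetrou hk hU hξ hp 2 0 2
  have e2 := pd_papapetrou hk hU hξ hp 3 0 2
  have e3 := pd_papapetrou hk hU hξ hp 2 0 3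
  rw [pd_eq_zero_of_eqOn hU h02 hp] at e1 e2
  rw [pd_eq_zero_of_eqOn hU h03 hp] at e3
  simp [Fin.sum_univ_four, riemannTab, normalTab, tidalTab, tidalLowTab, shapeTab, metricTab',
    christoffelTab, h02 p hp, h03 p hp, hd, papapetrou_swap hξ hp 3 2] at e1 e2 e3
  set u := flat (petrovMetric k) ξ 0 p
  set f := papapetrou (petrovMetric k) ξ 2 3 p
  have hf : f = 0 := by linarith
  rw [hf] at e1 e2
  have hC : u * fC p = 0 := by
    linear_combination -1 / 2 * e1 - √3 / 2 * e2 - u * fC p / 4 * h3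
  have hS : u * fS p = 0 := by
    linear_combination -√3 / 2 * e1 + 1 / 2 * e2 - u * fS p / 4 * h3
  linear_combination -u * h + fA p * fC p * hC + fA p * fS p * hS

/-- Each of the four derivatives of `(∇ξ)_xy` gives one equation: `∂_x` and `∂_y` isolate `ξ_y` and
`ξ_x` through the tidal tensor, while `∂_z` and `∂_t` apply the invertible `zt` block of the
connection to `((∇ξ)_yz, (∇ξ)_yt)`. -/
theorem papapetrou_of_xy_eq_zero {k : ℝ} (hk : k ≠ 0) {U : Set Pt} (hU : IsOpen U)
    {ξ : Pt → Pt} (hξ : IsKilling (petrovMetric k) U ξ)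
    (h01 : ∀ p ∈ U, papapetrou (petrovMetric k) ξ 0 1 p = 0) {p : Pt} (hp : p ∈ U) :
    flat (petrovMetric k) ξ 0 p = 0 ∧ flat (petrovMetric k) ξ 1 p = 0 ∧
      papapetrou (petrovMetric k) ξ 1 2 p = 0 ∧ papapetrou (petrovMetric k) ξ 1 3 p = 0 := by
  have h3 := sqrt_three_sq
  have hA := (fA_pos p).ne'
  have hd := papapetrou_self_eq_zero hξ hp
  have e0 := pd_papapetrou hk hU hξ hp 0 0 1
  have e1 := pd_papapetrou hk hU hξ hp 1 0 1
  have e2 := pd_papapetrou hk hU hξ hp 2 0 1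
  have e3 := pd_papapetrou hk hU hξ hp 3 0 1
  rw [pd_eq_zero_of_eqOn hU h01 hp] at e0 e1 e2 e3
  simp [Fin.sum_univ_four, riemannTab, normalTab, tidalTab, tidalLowTab, shapeTab, metricTab',
    christoffelTab, h01 p hp, hd, hA] at e0 e1 e2 e3
  refine ⟨e1, e0.symm, ?_, ?_⟩
  · linear_combination 1 / 2 * e2 - √3 / 2 * e3 - papapetrou (petrovMetric k) ξ 1 2 p / 4 * h3
  · linear_combination √3 / 2 * e2 + 1 / 2 * e3 - papapetrou (petrovMetric k) ξ 1 3 p / 4 * h3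

/-- The Killing field `∂_y`. -/
def translationY : Pt → Pt := fun _ => ![0, 1, 0, 0]

theorem eq_zero_of_flat_eq_zero {k : ℝ} (hk : k ≠ 0) {ξ : Pt → Pt} {p : Pt}
    (h2 : flat (petrovMetric k) ξ 2 p = 0) (h3 : flat (petrovMetric k) ξ 3 p = 0) :
    ξ p 2 = 0 ∧ ξ p 3 = 0 := by
  have h := fA_mul p
  have hk2 : (k ^ 2)⁻¹ ≠ 0 := inv_ne_zero (pow_ne_zero 2 hk)
  obtain ⟨-, -, e2, e3⟩ := flat_eq k ξ p
  rw [h2] at e2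
  rw [h3] at e3
  have f2 : fC p * ξ p 2 - fS p * ξ p 3 = 0 := (mul_eq_zero.1 e2.symm).resolve_left hk2
  have f3 : fS p * ξ p 2 + fC p * ξ p 3 = 0 :=
    (mul_eq_zero.1 (neg_eq_zero.1 e3.symm)).resolve_left hk2
  constructor
  · linear_combination -ξ p 2 * h + fA p * fC p * f2 + fA p * fS p * f3
  · linear_combination -ξ p 3 * h - fA p * fS p * f2 + fA p * fC p * f3

/-- A Killing field proportional to `∂_y` is a constant multiple of it. -/
theorem exists_eq_smul_translationY {k : ℝ} (hk : k ≠ 0) {U : Set Pt} (hU : IsOpen U)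
    (hc : IsPreconnected U) {ξ : Pt → Pt} (hξ : IsKilling (petrovMetric k) U ξ)
    (h0 : ∀ p ∈ U, flat (petrovMetric k) ξ 0 p = 0)
    (h2 : ∀ p ∈ U, flat (petrovMetric k) ξ 2 p = 0)
    (h3 : ∀ p ∈ U, flat (petrovMetric k) ξ 3 p = 0) :
    ∃ c : ℝ, ∀ p ∈ U, ξ p = c • translationY p := by
  have hk2 : (k ^ 2)⁻¹ ≠ 0 := inv_ne_zero (pow_ne_zero 2 hk)
  have hd : DifferentiableOn ℝ (fun q => ξ q 1) U := fun p hp =>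
    (((contDiff_apply ℝ ℝ 1).comp_contDiffOn hξ.1).differentiableOn (by simp)) p hp
  have hpd : ∀ p ∈ U, ∀ c, pd c (fun q => ξ q 1) p = 0 := by
    intro p hp c
    have hdp : DifferentiableAt ℝ (fun q => ξ q 1) p := (hd p hp).differentiableAt (hU.mem_nhds hp)
    have hdA : DifferentiableAt ℝ fA p := contDiff_fA.differentiable (by simp) p
    have hA := (fA_pos p).ne'
    have e := hξ.2 p hp c 1
    have hu : pd c (flat (petrovMetric k) ξ 1) p =
        (k ^ 2)⁻¹ * ((if c = 0 then -2 * fA p else 0) * ξ p 1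
          + fA p * pd c (fun q => ξ q 1) p) := by
      rw [show flat (petrovMetric k) ξ 1 = fun q => (k ^ 2)⁻¹ * (fA q * ξ q 1) from
        funext fun q => (flat_eq k ξ q).2.1, pd_const_mul (hdA.fun_mul hdp), pd_mul hdA hdp]
      have : pd c fA p = _ := pd_comp_coord (hasDerivAt_fA (p 0)) c
      rw [this]
      rfl
    have hy := (flat_eq k ξ p).2.1
    have p0 := pd_eq_zero_of_eqOn hU h0 hp 1
    have p2 := pd_eq_zero_of_eqOn hU h2 hp 1
    have p3 := pd_eq_zero_of_eqOn hU h3 hp 1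
    -- In the `(c, y)` component of the Killing equation the derivative of `e^{-2x}` cancels against
    -- `Γ^y_{xy} = -1`, so only `∂_c ξ^y` survives. For `c = y` it occurs twice.
    have key : (k ^ 2)⁻¹ * fA p * pd c (fun q => ξ q 1) p = 0 := by
      have e' : pd c (flat (petrovMetric k) ξ 1) p + pd 1 (flat (petrovMetric k) ξ c) p -
          2 * christoffelTab p 1 c 1 * flat (petrovMetric k) ξ 1 p = 0 := by
        have := christoffelTab_symm p 1 c 1
        simp only [papapetrou, christoffel_eq hk, Fin.sum_univ_four, h0 p hp, h2 p hp, h3 p hp] at e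
        linear_combination e - flat (petrovMetric k) ξ 1 p * this
      have hΓ : christoffelTab p 1 c 1 = if c = 0 then -1 else 0 := by
        fin_cases c <;> simp [christoffelTab]
      rw [hΓ, hu, hy] at e'
      fin_cases c
      · rw [show pd 1 (flat (petrovMetric k) ξ ((fun i => i) ⟨0, by decide⟩)) p = 0 from p0] at e'
        simp only [Fin.zero_eta, if_true] at e' ⊢
        linear_combination e'
      · rw [show pd 1 (flat (petrovMetric k) ξ ((fun i => i) ⟨1, by decide⟩)) p = _ from hu] at e'
        simp only [Fin.mk_one, one_ne_zero, if_false] at e' ⊢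
        linear_combination e' / 2
      · rw [show pd 1 (flat (petrovMetric k) ξ ((fun i => i) ⟨2, by decide⟩)) p = 0 from p2] at e'
        simp only [Fin.reduceFinMk, Fin.reduceEq, if_false] at e' ⊢
        linear_combination e'
      · rw [show pd 1 (flat (petrovMetric k) ξ ((fun i => i) ⟨3, by decide⟩)) p = 0 from p3] at e'
        simp only [Fin.reduceFinMk, Fin.reduceEq, if_false] at e' ⊢
        linear_combination e'
    exact (mul_eq_zero.1 key).resolve_left (mul_ne_zero hk2 hA)
  have hfd : U.EqOn (fderiv ℝ (fun q => ξ q 1)) 0 := by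
    intro p hp
    refine ContinuousLinearMap.coe_injective (LinearMap.pi_ext' fun c => LinearMap.ext_ring ?_)
    simpa [pd] using hpd p hp c
  obtain ⟨c, hc⟩ := hU.exists_is_const_of_fderiv_eq_zero hc hd hfd
  refine ⟨c, fun p hp => ?_⟩
  have e0 := (flat_eq k ξ p).1
  rw [h0 p hp] at e0
  have e23 := eq_zero_of_flat_eq_zero hk (h2 p hp) (h3 p hp)
  funext a
  fin_cases a
  · simpa [translationY, hk2] using e0.symm
  · simpa [translationY] using hc p hp
  · simpa [translationY] using e23.1
  · simpa [translationY] using e23.2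

/-- For the real eigenvalue, `F_xz = F_xt = 0` passes to `∇ξ` and the lemmas above apply. For a
complex eigenvalue `F_xy = 0` forces `(∇ξ)_yz = (∇ξ)_yt = 0`, and self-duality of `F` carries this
over to `(∇ξ)_xz` and `(∇ξ)_xt`. In that case `ξ_y` vanishes as well, so only the zero field occurs.
-/
theorem exists_eq_smul_translationY_of_isAligned {k : ℝ} (hk : k ≠ 0) {σ : ℤˣ} {U : Set Pt}
    (hU : IsOpen U) (hc : IsPreconnected U) {ξ : Pt → Pt} (hξ : IsKilling (petrovMetric k) U ξ)
    (ha : IsAligned σ (petrovMetric k) U ξ) : ∃ c : ℝ, ∀ p ∈ U, ξ p = c • translationY p := by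
  obtain ⟨F, ⟨hF, hprop⟩, Ω, hΩ⟩ := ha
  have hs : ∀ p ∈ U, F p = sdTab σ p (F p 0 1) (F p 0 2) (F p 0 3) := fun p hp =>
    eq_sdTab hk (hprop p hp).2.1 (hprop p hp).2.2.1
  choose! α hα using fun p hp => (hprop p hp).2.2.2
  rcases eigenbivector_cases hk hc hF (fun p hp => (hprop p hp).1) hs hα with h | ⟨τ, h⟩
  · have h02 : ∀ p ∈ U, papapetrou (petrovMetric k) ξ 0 2 p = 0 := fun p hp => by
      have := hΩ p hp 0 2
      rw [(h p hp).2.1] at this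
      exact_mod_cast this.trans (by simp : _ = (0 : ℂ))
    have h03 : ∀ p ∈ U, papapetrou (petrovMetric k) ξ 0 3 p = 0 := fun p hp => by
      have := hΩ p hp 0 3
      rw [(h p hp).2.2.1] at this
      exact_mod_cast this.trans (by simp : _ = (0 : ℂ))
    exact exists_eq_smul_translationY hk hU hc hξ (fun p hp => flat_x_eq_zero hk hU hξ h02 h03 hp)
      (fun p hp => (flat_eq_zero_of_papapetrou_xz_xt hk hU hξ h02 h03 hp).1)
      (fun p hp => (flat_eq_zero_of_papapetrou_xz_xt hk hU hξ h02 h03 hp).2)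
  · have h01 : ∀ p ∈ U, papapetrou (petrovMetric k) ξ 0 1 p = 0 := fun p hp => by
      have := hΩ p hp 0 1
      rw [(h p hp).2.1] at this
      exact_mod_cast this.trans (by simp : _ = (0 : ℂ))
    have key := fun p hp => papapetrou_of_xy_eq_zero hk hU hξ h01 (p := p) hp
    have hzero : ∀ p ∈ U, papapetrou (petrovMetric k) ξ 0 2 p = 0 ∧
        papapetrou (petrovMetric k) ξ 0 3 p = 0 := by
      intro p hp
      have hA := fA_mul_complex p
      have hσ := units_sq_complex σ
      have hτ := units_sq_complex τ
      have hI := Complex.I_sq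
      obtain ⟨-, -, h12, h13⟩ := key p hp
      have e02 := hΩ p hp 0 2
      have e03 := hΩ p hp 0 3
      have e12 := hΩ p hp 1 2
      have e13 := hΩ p hp 1 3
      rw [h12] at e12
      rw [h13] at e13
      have s12 : F p 1 2 = sdTab σ p (F p 0 1) (F p 0 2) (F p 0 3) 1 2 :=
        congrFun (congrFun (hs p hp) 1) 2
      have s13 : F p 1 3 = sdTab σ p (F p 0 1) (F p 0 2) (F p 0 3) 1 3 :=
        congrFun (congrFun (hs p hp) 1) 3
      simp only [sdTab, (h p hp).2.2.1, Matrix.of_apply, Matrix.cons_val] at s12 s13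
      rw [s12] at e12
      rw [s13] at e13
      rw [(h p hp).2.2.1] at e03
      simp only [map_mul, map_add, map_sub, Complex.conj_I, Complex.conj_ofReal, map_intCast,
        Complex.ofReal_zero] at e02 e03 e12 e13
      generalize (papapetrou (petrovMetric k) ξ 0 2 p) = m at *
      generalize (papapetrou (petrovMetric k) ξ 0 3 p) = n at *
      generalize ((σ : ℤ) : ℂ) = s at *
      generalize ((τ : ℤ) : ℂ) = t at *
      generalize Ω p = x at *
      generalize F p 0 2 = v at *
      generalize (starRingEnd ℂ) x = x' at *
      generalize (starRingEnd ℂ) v = v' at *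
      -- Since `F_xt = iτ F_xz`, the components `F_yz` and `F_yt` are real combinations of `F_xz`
      -- and `F_xt`, and the relation survives taking real parts. Its matrix is `στ e^{-2x}` times
      -- one with entries `±fC`, `±fS`, hence invertible.
      have hX : s * t * fA p * (fC p * m - fS p * n) = 0 := by
        rw [e02, e03]
        linear_combination e12 + s * t * fA p * fC p * (x * v + x' * v') * hI
          - Complex.I * s * fA p * fS p * (x * v - x' * v') * hτ
      have hY : s * t * fA p * (fC p * n + fS p * m) = 0 := by
        rw [e02, e03]
        linear_combination -e13 + s * t * fA p * fS p * (x * v + x' * v') * hI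
          + Complex.I * s * fA p * fC p * (x * v - x' * v') * hτ
      constructor
      · have : (m : ℂ) = 0 := by
          linear_combination s * t * fC p * hX + s * t * fS p * hY - m * s ^ 2 * t ^ 2 * hA
            - m * t ^ 2 * hσ - m * hτ
        exact_mod_cast this
      · have : (n : ℂ) = 0 := by
          linear_combination -s * t * fS p * hX + s * t * fC p * hY - n * s ^ 2 * t ^ 2 * hA
            - n * t ^ 2 * hσ - n * hτ
        exact_mod_cast this
    have h23 := fun p hp => flat_eq_zero_of_papapetrou_xz_xt hk hU hξ (fun p hp => (hzero p hp).1)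
      (fun p hp => (hzero p hp).2) (p := p) hp
    exact exists_eq_smul_translationY hk hU hc hξ (fun p hp => (key p hp).1)
      (fun p hp => (h23 p hp).1) (fun p hp => (h23 p hp).2)

theorem flat_translationY (k : ℝ) (a : Fin 4) (p : Pt) :
    flat (petrovMetric k) translationY a p = if a = 1 then (k ^ 2)⁻¹ * fA p else 0 := by
  obtain ⟨h0, h1, h2, h3⟩ := flat_eq k translationY p
  fin_cases a
  · simpa [translationY] using h0
  · simpa [translationY] using h1
  · simpa [translationY] using h2
  · simpa [translationY] using h3

theorem pd_fA (c : Fin 4) (p : Pt) : pd c fA p = if c = 0 then -2 * fA p else 0 :=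
  pd_comp_coord (hasDerivAt_fA (p 0)) c

theorem pd_fC (c : Fin 4) (p : Pt) : pd c fC p = if c = 0 then fC p - √3 * fS p else 0 :=
  pd_comp_coord (hasDerivAt_fC (p 0)) c

theorem pd_fS (c : Fin 4) (p : Pt) : pd c fS p = if c = 0 then fS p + √3 * fC p else 0 :=
  pd_comp_coord (hasDerivAt_fS (p 0)) c

theorem papapetrou_translationY {k : ℝ} (hk : k ≠ 0) (a b : Fin 4) (p : Pt) :
    papapetrou (petrovMetric k) translationY a b p = (k ^ 2)⁻¹ * fA p *
      !![0, -1, 0, 0; 1, 0, 0, 0; 0, 0, 0, 0; 0, 0, 0, 0] a b := by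
  have hpd : pd a (flat (petrovMetric k) translationY b) p =
      if b = 1 then (k ^ 2)⁻¹ * (if a = 0 then -2 * fA p else 0) else 0 := by
    rw [show flat (petrovMetric k) translationY b =
      fun q => if b = 1 then (k ^ 2)⁻¹ * fA q else 0 from funext fun q => flat_translationY k b q]
    split_ifs with h
    · rw [pd_const_mul (contDiff_fA.differentiable (by simp) p), pd_fA, if_pos ‹_›]
    · rw [pd_const_mul (contDiff_fA.differentiable (by simp) p), pd_fA, if_neg ‹_›]
    · simp [pd]
  simp only [papapetrou, hpd, christoffel_eq hk, flat_translationY, Fin.sum_univ_four]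
  fin_cases a <;> fin_cases b <;> simp [christoffelTab]
  ring

theorem isKilling_translationY {k : ℝ} (hk : k ≠ 0) (U : Set Pt) :
    IsKilling (petrovMetric k) U translationY := by
  refine ⟨contDiffOn_const, fun p _ a b => ?_⟩
  rw [papapetrou_translationY hk, papapetrou_translationY hk]
  fin_cases a <;> fin_cases b <;> simp

/-- The factor `Ω` makes `(ΩF)_xy` real and equal to half of the wanted component. By self-duality
`(ΩF)_zt` is then purely imaginary and disappears on adding the conjugate. -/
theorem alignedWith_translationY {k : ℝ} (hk : k ≠ 0) {σ : ℤˣ} {U : Set Pt} {F : TwoTensor}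
    (hF : ∀ p ∈ U, F p = sdTab σ p (F p 0 1) 0 0 ∧ F p 0 1 ≠ 0) :
    AlignedWith (petrovMetric k) U translationY F := by
  refine ⟨fun p => -((k ^ 2)⁻¹ * fA p / 2 : ℝ) / F p 0 1, fun p hp a b => ?_⟩
  obtain ⟨h1, h2⟩ := hF p hp
  have h3 : ∀ a b, -(((k ^ 2)⁻¹ * fA p / 2 : ℝ) : ℂ) / F p 0 1 * F p a b =
      sdTab σ p (-(((k ^ 2)⁻¹ * fA p / 2 : ℝ) : ℂ)) 0 0 a b := fun a b => by
    have := sdTab_smul σ p (F p 0 1) 0 0 (-(((k ^ 2)⁻¹ * fA p / 2 : ℝ) : ℂ) / F p 0 1)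
    rw [mul_zero, div_mul_cancel₀ _ h2] at this
    rw [this]
    exact congrArg _ (congrFun (congrFun h1 a) b)
  simp only [h3, papapetrou_translationY hk]
  fin_cases a <;> fin_cases b <;> simp [sdTab, map_ofNat]
  all_goals ring

/-! ### Covariant derivatives of self-dual 2-forms -/

theorem pd_ofReal {f : Pt → ℝ} {p : Pt} (hf : DifferentiableAt ℝ f p) (c : Fin 4) :
    pd c (fun q => (f q : ℂ)) p = ((pd c f p : ℝ) : ℂ) := by
  unfold pd
  have h : HasFDerivAt (fun q => (f q : ℂ)) (Complex.ofRealCLM.comp (fderiv ℝ f p)) p :=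
    Complex.ofRealCLM.hasFDerivAt.comp p hf.hasFDerivAt
  rw [h.fderiv]
  rfl

theorem differentiableAt_ofReal {f : Pt → ℝ} {p : Pt} (hf : DifferentiableAt ℝ f p) :
    DifferentiableAt ℝ (fun q => (f q : ℂ)) p :=
  Complex.ofRealCLM.differentiableAt.comp p hf

/-- The component `∇_c F_{xy}` of the covariant derivative of a self-dual 2-form with components
`u`, `v`, `w`, where `u'` stands for `∂_c u`. -/
def covTabU (σ : ℤˣ) (p : Pt) (u v w u' : ℂ) (c : Fin 4) : ℂ :=
  u' + ![u, 0, sdTab σ p u v w 1 2 / 2 + √3 / 2 * sdTab σ p u v w 1 3,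
    -(√3 / 2 * sdTab σ p u v w 1 2) + sdTab σ p u v w 1 3 / 2] c

/-- The component `∇_c F_{xz}` of the covariant derivative of a self-dual 2-form with components
`u`, `v`, `w`, where `v'` stands for `∂_c v`. -/
def covTabV (σ : ℤˣ) (p : Pt) (u v w v' : ℂ) (c : Fin 4) : ℂ :=
  v' + ![-(v / 2) - √3 / 2 * w, sdTab σ p u v w 1 2, √3 / 2 * sdTab σ p u v w 2 3,
    sdTab σ p u v w 2 3 / 2] c

/-- The component `∇_c F_{xt}` of the covariant derivative of a self-dual 2-form with components
`u`, `v`, `w`, where `w'` stands for `∂_c w`. -/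
def covTabW (σ : ℤˣ) (p : Pt) (u v w w' : ℂ) (c : Fin 4) : ℂ :=
  w' + ![√3 / 2 * v - w / 2, sdTab σ p u v w 1 3, -(sdTab σ p u v w 2 3 / 2),
    √3 / 2 * sdTab σ p u v w 2 3] c

theorem covDeriv_swap {U : Set Pt} (hU : IsOpen U) (g : MetricField) {F : TwoTensor}
    (hF : ∀ p ∈ U, ∀ a b, F p a b = -F p b a) {p : Pt} (hp : p ∈ U) (c a b : Fin 4) :
    covDeriv g F c a b p = -covDeriv g F c b a p := by
  have h : pd c (fun q => F q a b) p = -pd c (fun q => F q b a) p := by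
    rw [pd_congr (Filter.eventually_of_mem (hU.mem_nhds hp) fun q hq => hF q hq a b)]
    unfold pd
    rw [fderiv_fun_neg]
    rfl
  have h2 : ∑ d, ((christoffel g d c a p : ℂ) * F p d b + (christoffel g d c b p : ℂ) * F p a d) =
      -∑ d, ((christoffel g d c b p : ℂ) * F p d a + (christoffel g d c a p : ℂ) * F p b d) := by
    rw [← Finset.sum_neg_distrib]
    refine Finset.sum_congr rfl fun d _ => ?_
    rw [hF p hp d b, hF p hp a d]
    ring
  rw [covDeriv, covDeriv, h, h2]
  ring

/-- The covariant derivative of a self-dual 2-form is self-dual. -/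
theorem covDeriv_eq_sdTab {k : ℝ} (hk : k ≠ 0) {σ : ℤˣ} {U : Set Pt} (hU : IsOpen U)
    {F : TwoTensor} (hs : ∀ p ∈ U, F p = sdTab σ p (F p 0 1) (F p 0 2) (F p 0 3))
    (hd : ∀ a b, DifferentiableOn ℝ (fun q => F q a b) U) {p : Pt} (hp : p ∈ U) (c a b : Fin 4) :
    covDeriv (petrovMetric k) F c a b p = sdTab σ p
      (covTabU σ p (F p 0 1) (F p 0 2) (F p 0 3) (pd c (fun q => F q 0 1) p) c)
      (covTabV σ p (F p 0 1) (F p 0 2) (F p 0 3) (pd c (fun q => F q 0 2) p) c)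
      (covTabW σ p (F p 0 1) (F p 0 2) (F p 0 3) (pd c (fun q => F q 0 3) p) c) a b := by
  have hanti : ∀ p ∈ U, ∀ a b, F p a b = -F p b a := fun p hp a b => by
    rw [hs p hp]; exact sdTab_antisymm _ _ _ _ _ a b
  have hA := fA_mul_complex p
  -- Orientation and imaginary unit enter only through `K = iσ` with `K² = -1`, so one computation
  -- serves both orientations.
  obtain ⟨K, hKσ, hK⟩ : ∃ K : ℂ, Complex.I * (σ : ℤ) = K ∧ K ^ 2 = -1 :=
    ⟨_, rfl, by rw [mul_pow, Complex.I_sq, units_sq_complex, mul_one]⟩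
  have dF : ∀ a b, DifferentiableAt ℝ (fun q => F q a b) p := fun a b =>
    (hd a b p hp).differentiableAt (hU.mem_nhds hp)
  have dA := (contDiff_fA.differentiable (by simp)) p
  have dC := (contDiff_fC.differentiable (by simp)) p
  have dS := (contDiff_fS.differentiable (by simp)) p
  have cA : DifferentiableAt ℝ (fun q => (fA q : ℂ)) p := differentiableAt_ofReal dA
  have cC : DifferentiableAt ℝ (fun q => (fC q : ℂ)) p := differentiableAt_ofReal dC
  have cS : DifferentiableAt ℝ (fun q => (fS q : ℂ)) p := differentiableAt_ofReal dS
  have s12 : ∀ q ∈ U, F q 1 2 = K * (fA q * (fS q * F q 0 2 + fC q * F q 0 3)) := fun q hq => by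
    rw [hs q hq]; simp only [sdTab, hKσ]; simp; ring
  have s13 : ∀ q ∈ U, F q 1 3 = K * (fA q * (fC q * F q 0 2 - fS q * F q 0 3)) := fun q hq => by
    rw [hs q hq]; simp only [sdTab, hKσ]; simp; ring
  have s23 : ∀ q ∈ U, F q 2 3 = -K * ((fC q * fC q + fS q * fS q) * F q 0 1) := fun q hq => by
    rw [hs q hq]; simp only [sdTab, hKσ]; simp; ring
  have p12 : pd c (fun q => F q 1 2) p = K * ((pd c fA p : ℝ) * (fS p * F p 0 2 + fC p * F p 0 3) +
      fA p * ((pd c fS p : ℝ) * F p 0 2 + fS p * pd c (fun q => F q 0 2) p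
        + ((pd c fC p : ℝ) * F p 0 3 + fC p * pd c (fun q => F q 0 3) p))) := by
    rw [pd_congr (Filter.eventually_of_mem (hU.mem_nhds hp) s12),
      pd_const_mul (cA.fun_mul ((cS.fun_mul (dF 0 2)).fun_add (cC.fun_mul (dF 0 3)))),
      pd_mul cA ((cS.fun_mul (dF 0 2)).fun_add (cC.fun_mul (dF 0 3))),
      pd_add (cS.fun_mul (dF 0 2)) (cC.fun_mul (dF 0 3)), pd_mul cS (dF 0 2), pd_mul cC (dF 0 3),
      pd_ofReal dA, pd_ofReal dC, pd_ofReal dS]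
  have p13 : pd c (fun q => F q 1 3) p = K * ((pd c fA p : ℝ) * (fC p * F p 0 2 - fS p * F p 0 3) +
      fA p * ((pd c fC p : ℝ) * F p 0 2 + fC p * pd c (fun q => F q 0 2) p
        - ((pd c fS p : ℝ) * F p 0 3 + fS p * pd c (fun q => F q 0 3) p))) := by
    rw [pd_congr (Filter.eventually_of_mem (hU.mem_nhds hp) s13),
      pd_const_mul (cA.fun_mul ((cC.fun_mul (dF 0 2)).fun_sub (cS.fun_mul (dF 0 3)))),
      pd_mul cA ((cC.fun_mul (dF 0 2)).fun_sub (cS.fun_mul (dF 0 3))),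
      pd_sub (cC.fun_mul (dF 0 2)) (cS.fun_mul (dF 0 3)), pd_mul cC (dF 0 2), pd_mul cS (dF 0 3),
      pd_ofReal dA, pd_ofReal dC, pd_ofReal dS]
  have p23 : pd c (fun q => F q 2 3) p = -K * (((pd c fC p : ℝ) * fC p + fC p * (pd c fC p : ℝ)
      + ((pd c fS p : ℝ) * fS p + fS p * (pd c fS p : ℝ))) * F p 0 1
      + (fC p * fC p + fS p * fS p) * pd c (fun q => F q 0 1) p) := by
    rw [pd_congr (Filter.eventually_of_mem (hU.mem_nhds hp) s23),
      pd_const_mul (((cC.fun_mul cC).fun_add (cS.fun_mul cS)).fun_mul (dF 0 1)),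
      pd_mul ((cC.fun_mul cC).fun_add (cS.fun_mul cS)) (dF 0 1),
      pd_add (cC.fun_mul cC) (cS.fun_mul cS), pd_mul cC cC, pd_mul cS cS,
      pd_ofReal dC, pd_ofReal dS]
  have hz : ∀ a, F p a a = 0 := fun a => self_eq_neg.1 (hanti p hp a a)
  wlog hab : a < b generalizing a b
  · rcases lt_or_eq_of_le (not_lt.1 hab) with h | h
    · rw [covDeriv_swap hU _ hanti hp, sdTab_antisymm, this b a h]
    · subst h
      have h1 := covDeriv_swap hU (petrovMetric k) hanti hp c b b
      rw [self_eq_neg.1 h1]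
      exact (self_eq_neg.1 (sdTab_antisymm _ _ _ _ _ b b)).symm
  rw [pd_fA, pd_fC, pd_fS] at p12 p13
  rw [pd_fC, pd_fS] at p23
  -- This relation is the cancellation behind `** = -1`. It is used with the multiplier `x` read off
  -- from the discrepancy of each component.
  have hX : ∀ x : ℂ, x * (1 + K ^ 2 * (fA p * (fC p ^ 2 + fS p ^ 2))) = 0 := fun x => by
    rw [hA, hK]; ring
  have t12 := s12 p hp
  have t13 := s13 p hp
  have t23 := s23 p hp
  have t10 := hanti p hp 1 0
  have t20 := hanti p hp 2 0
  have t30 := hanti p hp 3 0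
  have t21 := hanti p hp 2 1
  have t31 := hanti p hp 3 1
  have t32 := hanti p hp 3 2
  have h01 : covDeriv (petrovMetric k) F c 0 1 p =
      covTabU σ p (F p 0 1) (F p 0 2) (F p 0 3) (pd c (fun q => F q 0 1) p) c := by
    simp only [covDeriv, christoffel_eq hk, Fin.sum_univ_four, covTabU]
    generalize pd c (fun q => F q 0 1) p = u'
    fin_cases c <;> simp [christoffelTab, hz, t21, t31, t12, t13] <;> (try simp [sdTab, hKσ]) <;>
      ring
  have h02 : covDeriv (petrovMetric k) F c 0 2 p =
      covTabV σ p (F p 0 1) (F p 0 2) (F p 0 3) (pd c (fun q => F q 0 2) p) c := by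
    simp only [covDeriv, christoffel_eq hk, Fin.sum_univ_four, covTabV]
    generalize pd c (fun q => F q 0 2) p = u'
    fin_cases c <;> simp [christoffelTab, hz, t32, t12, t23] <;> (try simp [sdTab, hKσ]) <;>
      ring
  have h03 : covDeriv (petrovMetric k) F c 0 3 p =
      covTabW σ p (F p 0 1) (F p 0 2) (F p 0 3) (pd c (fun q => F q 0 3) p) c := by
    simp only [covDeriv, christoffel_eq hk, Fin.sum_univ_four, covTabW]
    generalize pd c (fun q => F q 0 3) p = u'
    fin_cases c <;> simp [christoffelTab, hz, t13, t23] <;> (try simp [sdTab, hKσ]) <;>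
      ring
  have h12 : covDeriv (petrovMetric k) F c 1 2 p = K * fA p * (fS p *
      covTabV σ p (F p 0 1) (F p 0 2) (F p 0 3) (pd c (fun q => F q 0 2) p) c + fC p *
      covTabW σ p (F p 0 1) (F p 0 2) (F p 0 3) (pd c (fun q => F q 0 3) p) c) := by
    simp only [covDeriv, christoffel_eq hk, Fin.sum_univ_four, covTabV, covTabW, p12]
    clear h01 h02 h03 p12 p13 p23
    generalize pd c (fun q => F q 0 2) p = v'
    generalize pd c (fun q => F q 0 3) p = w'
    fin_cases c <;> simp [christoffelTab, hz, t10, t12, t13] <;> try simp [sdTab, hKσ]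
    · ring
    · linear_combination hX (-fA p * F p 0 2)
    · linear_combination hX (-(fC p - √3 * fS p) / 2 * F p 0 1)
    · linear_combination hX ((fS p + √3 * fC p) / 2 * F p 0 1)
  have h13 : covDeriv (petrovMetric k) F c 1 3 p = K * fA p * (fC p *
      covTabV σ p (F p 0 1) (F p 0 2) (F p 0 3) (pd c (fun q => F q 0 2) p) c - fS p *
      covTabW σ p (F p 0 1) (F p 0 2) (F p 0 3) (pd c (fun q => F q 0 3) p) c) := by
    simp only [covDeriv, christoffel_eq hk, Fin.sum_univ_four, covTabV, covTabW, p13]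
    clear h01 h02 h03 p12 p13 p23 h12
    generalize pd c (fun q => F q 0 2) p = v'
    generalize pd c (fun q => F q 0 3) p = w'
    fin_cases c <;> simp [christoffelTab, hz, t10, t12, t13] <;> try simp [sdTab, hKσ]
    · ring
    · linear_combination hX (-fA p * F p 0 3)
    · linear_combination hX ((fS p + √3 * fC p) / 2 * F p 0 1)
    · linear_combination hX ((fC p - √3 * fS p) / 2 * F p 0 1)
  have h23 : covDeriv (petrovMetric k) F c 2 3 p = -(K * (fC p ^ 2 + fS p ^ 2) *
      covTabU σ p (F p 0 1) (F p 0 2) (F p 0 3) (pd c (fun q => F q 0 1) p) c) := by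
    simp only [covDeriv, christoffel_eq hk, Fin.sum_univ_four, covTabU, p23]
    clear h01 h02 h03 p12 p13 p23 h12 h13
    generalize pd c (fun q => F q 0 1) p = u'
    fin_cases c <;> simp [christoffelTab, hz, t20, t23] <;> try simp [sdTab, hKσ]
    · ring
    · ring
    · linear_combination hX ((fC p - √3 * fS p) / 2 * F p 0 3 + (fS p + √3 * fC p) / 2 * F p 0 2)
    · linear_combination hX (-(fS p + √3 * fC p) / 2 * F p 0 3 + (fC p - √3 * fS p) / 2 * F p 0 2)
  rw [← hKσ] at h12 h13 h23
  fin_cases a <;> fin_cases b <;>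
    first
    | exact absurd hab (by decide)
    | exact h01
    | exact h02
    | exact h03
    | exact h12
    | exact h13
    | exact h23

/-! ### Bivectors of orthonormal tetrads -/

/-- The 2-form `e_0 ∧ e_i` of a tetrad, with indices lowered. -/
def wedge (g : MetricField) (e : Fin 4 → Pt → Pt) (i : Fin 3) : TwoTensor := fun p a b =>
  ((flat g (e 0) a p * flat g (e i.succ) b p - flat g (e 0) b p * flat g (e i.succ) a p : ℝ) : ℂ)

theorem wedge_antisymm (g : MetricField) (e : Fin 4 → Pt → Pt) (i : Fin 3) (p : Pt) (a b : Fin 4) :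
    wedge g e i p a b = -wedge g e i p b a := by
  unfold wedge; push_cast; ring

theorem frameBivector_apply {k : ℝ} (hk : k ≠ 0) (σ : ℤˣ) (e : Fin 4 → Pt → Pt) (i : Fin 3)
    (p : Pt) (a b : Fin 4) : frameBivector σ (petrovMetric k) e i p a b =
      ((√2 : ℝ) : ℂ)⁻¹ * (wedge (petrovMetric k) e i p a b
        - Complex.I * hodgeTab σ p (wedge (petrovMetric k) e i p) a b) := by
  rw [← hodge_eq hk σ (wedge_antisymm _ e i p)]
  rfl

/-- As `** = -1` on 2-forms in Lorentzian signature, `V - i*V` is self-dual for every `V`. -/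
theorem frameBivector_eq_sdTab {k : ℝ} (hk : k ≠ 0) (σ : ℤˣ) (e : Fin 4 → Pt → Pt) (i : Fin 3)
    (p : Pt) : frameBivector σ (petrovMetric k) e i p = sdTab σ p
      (frameBivector σ (petrovMetric k) e i p 0 1) (frameBivector σ (petrovMetric k) e i p 0 2)
      (frameBivector σ (petrovMetric k) e i p 0 3) := by
  have hA := fA_mul_complex p
  have hσ := units_sq_complex σ
  have hI := Complex.I_sq
  have hw := wedge_antisymm (petrovMetric k) e i p
  have hz : ∀ a, wedge (petrovMetric k) e i p a a = 0 := fun a => self_eq_neg.1 (hw a a)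
  funext a b
  simp only [frameBivector_apply hk]
  have h10 := hw 1 0
  have h20 := hw 2 0
  have h30 := hw 3 0
  have h21 := hw 2 1
  have h31 := hw 3 1
  have h32 := hw 3 2
  generalize wedge (petrovMetric k) e i p = V at *
  generalize ((√2 : ℝ) : ℂ)⁻¹ = r at *
  have hX : ∀ x : ℂ, x * (1 + Complex.I ^ 2 * ((σ : ℤ) : ℂ) ^ 2 * (fA p * (fC p ^ 2 + fS p ^ 2)))
      = 0 := fun x => by
    rw [hA, hσ, hI]; ring
  fin_cases a <;> fin_cases b <;> simp [hodgeTab, sdTab, hz, h10, h20, h30, h21, h31, h32]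
  all_goals
    first
    | ring1
    | linear_combination hX (r * V 1 2)
    | linear_combination hX (-r * V 1 2)
    | linear_combination hX (r * V 1 3)
    | linear_combination hX (-r * V 1 3)
    | linear_combination hX (r * V 2 3)
    | linear_combination hX (-r * V 2 3)

theorem contDiffOn_frameBivector {k : ℝ} (hk : k ≠ 0) (σ : ℤˣ) {U : Set Pt} {e : Fin 4 → Pt → Pt}
    (he : ∀ m, ContDiffOn ℝ ∞ (e m) U) (i : Fin 3) :
    ContDiffOn ℝ ∞ (frameBivector σ (petrovMetric k) e i) U := by
  have hV : ∀ a b, ContDiffOn ℝ ∞ (fun p => wedge (petrovMetric k) e i p a b) U := fun a b => by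
    have h := fun m a => contDiffOn_flat k (he m) a
    exact Complex.ofRealCLM.contDiff.comp_contDiffOn
      (((h 0 a).mul (h i.succ b)).sub ((h 0 b).mul (h i.succ a)))
  have hA : ContDiffOn ℝ ∞ (fun p => (fA p : ℂ)) U :=
    Complex.ofRealCLM.contDiff.comp_contDiffOn contDiff_fA.contDiffOn
  have hC : ContDiffOn ℝ ∞ (fun p => (fC p : ℂ)) U :=
    Complex.ofRealCLM.contDiff.comp_contDiffOn contDiff_fC.contDiffOn
  have hS : ContDiffOn ℝ ∞ (fun p => (fS p : ℂ)) U :=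
    Complex.ofRealCLM.contDiff.comp_contDiffOn contDiff_fS.contDiffOn
  refine contDiffOn_pi.2 fun a => contDiffOn_pi.2 fun b => ?_
  simp only [frameBivector_apply hk]
  refine contDiffOn_const.mul ((hV a b).sub (contDiffOn_const.mul ?_))
  generalize wedge (petrovMetric k) e i = V at *
  have h01 := hV 0 1
  have h02 := hV 0 2
  have h03 := hV 0 3
  have h12 := hV 1 2
  have h13 := hV 1 3
  have h23 := hV 2 3
  fin_cases a <;> fin_cases b <;> simp [hodgeTab] <;> fun_prop

/-- The metric on self-dual 2-forms, in the components `F_{xy}`, `F_{xz}`, `F_{xt}`. -/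
def sdForm (p : Pt) (F G : Fin 4 → Fin 4 → ℂ) : ℂ :=
  (fC p ^ 2 + fS p ^ 2) * (F 0 1 * G 0 1) + fA p * (fC p * (F 0 2 * G 0 2)
    - fS p * (F 0 2 * G 0 3 + F 0 3 * G 0 2) - fC p * (F 0 3 * G 0 3))

/-- The inverse metric on covectors. -/
theorem sum_flat_mul_eq {k : ℝ} (hk : k ≠ 0) (ξ ζ : Pt → Pt) (p : Pt) :
    ∑ a, flat (petrovMetric k) ξ a p * ζ p a = k ^ 2 *
      (flat (petrovMetric k) ξ 0 p * flat (petrovMetric k) ζ 0 p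
        + (fC p ^ 2 + fS p ^ 2) * (flat (petrovMetric k) ξ 1 p * flat (petrovMetric k) ζ 1 p)
        + fA p * (fC p * (flat (petrovMetric k) ξ 2 p * flat (petrovMetric k) ζ 2 p)
        - fS p * (flat (petrovMetric k) ξ 2 p * flat (petrovMetric k) ζ 3 p
          + flat (petrovMetric k) ξ 3 p * flat (petrovMetric k) ζ 2 p)
        - fC p * (flat (petrovMetric k) ξ 3 p * flat (petrovMetric k) ζ 3 p))) := by
  have hA := fA_mul p
  have hk2 : k ^ 2 * (k ^ 2)⁻¹ = 1 := mul_inv_cancel₀ (pow_ne_zero 2 hk)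
  obtain ⟨h0, h1, h2, h3⟩ := flat_eq k ζ p
  rw [Fin.sum_univ_four, h0, h1, h2, h3]
  generalize flat (petrovMetric k) ξ 0 p = x0
  generalize flat (petrovMetric k) ξ 1 p = x1
  generalize flat (petrovMetric k) ξ 2 p = x2
  generalize flat (petrovMetric k) ξ 3 p = x3
  linear_combination -(x0 * ζ p 0 + x1 * ζ p 1 + x2 * ζ p 2 + x3 * ζ p 3) * hk2
    - k ^ 2 * (k ^ 2)⁻¹ * (x1 * ζ p 1 + x2 * ζ p 2 + x3 * ζ p 3) * hA

/-- For real forms and real `r` the right side splits into the inner product of `V` and `W` as real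
part and a multiple of `V ∧ W` as imaginary part. For `V = e_0 ∧ e_i` and `W = e_0 ∧ e_j` the wedge
vanishes because of the common factor. -/
theorem sdForm_selfDual (σ : ℤˣ) (p : Pt) (r : ℂ) (V W : Fin 4 → Fin 4 → ℂ) :
    sdForm p (fun a b => r * (V a b - Complex.I * hodgeTab σ p V a b))
      (fun a b => r * (W a b - Complex.I * hodgeTab σ p W a b)) =
    r ^ 2 * (sdForm p V W + (fC p * (V 1 2 * W 1 2) - fS p * (V 1 2 * W 1 3 + V 1 3 * W 1 2)
      - fC p * (V 1 3 * W 1 3)) - fA p * (V 2 3 * W 2 3)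
      + Complex.I * (σ : ℤ) * (V 0 1 * W 2 3 - V 0 2 * W 1 3 + V 0 3 * W 1 2
        + V 2 3 * W 0 1 - V 1 3 * W 0 2 + V 1 2 * W 0 3)) := by
  have hA := fA_mul_complex p
  have hσ := units_sq_complex σ
  have hI := Complex.I_sq
  simp [sdForm, hodgeTab]
  linear_combination r ^ 2 * (fA p * (V 2 3 * W 2 3) - (fC p * (V 1 2 * W 1 2)
    - fS p * (V 1 2 * W 1 3 + V 1 3 * W 1 2) - fC p * (V 1 3 * W 1 3))) *
    (Complex.I ^ 2 * ((σ : ℤ) : ℂ) ^ 2 * hA + ((σ : ℤ) : ℂ) ^ 2 * hI - hσ)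
    + r ^ 2 * Complex.I * (σ : ℤ) * (V 0 1 * W 2 3 - V 0 2 * W 1 3 + V 0 3 * W 1 2
        + V 2 3 * W 0 1 - V 1 3 * W 0 2 + V 1 2 * W 0 3) * hA

/-- The bivectors of an orthonormal tetrad are orthogonal and normalized. -/
theorem sdForm_frameBivector {k : ℝ} (hk : k ≠ 0) (σ : ℤˣ) {e : Fin 4 → Pt → Pt} {p : Pt}
    (he : ∀ m n, ∑ a, flat (petrovMetric k) (e m) a p * e n p a =
      if m = n then (if m = 0 then -1 else 1) else 0) (i j : Fin 3) :
    (k : ℂ) ^ 4 * sdForm p (frameBivector σ (petrovMetric k) e i p)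
      (frameBivector σ (petrovMetric k) e j p) = if i = j then -2⁻¹ else 0 := by
  have hA := fA_mul_complex p
  have h2 : (((√2 : ℝ) : ℂ)⁻¹) ^ 2 = 2⁻¹ := by
    rw [inv_pow, ← Complex.ofReal_pow, Real.sq_sqrt (by norm_num)]; norm_num
  simp only [sum_flat_mul_eq hk] at he
  have e00 := he 0 0
  have e0i := he 0 i.succ
  have eij := he i.succ j.succ
  rw [if_neg (Fin.succ_ne_zero _).symm] at e0i
  simp only [if_true, Fin.succ_inj, Fin.succ_ne_zero, if_false] at e00 eij
  have key : sdForm p (frameBivector σ (petrovMetric k) e i p)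
      (frameBivector σ (petrovMetric k) e j p) = _ :=
    (congrArg₂ (sdForm p) (funext fun a => funext fun b => frameBivector_apply hk σ e i p a b)
      (funext fun a => funext fun b => frameBivector_apply hk σ e j p a b)).trans
      (sdForm_selfDual σ p _ _ _)
  have hcast : (k : ℂ) ^ 4 * sdForm p (frameBivector σ (petrovMetric k) e i p)
      (frameBivector σ (petrovMetric k) e j p) = -2⁻¹ * ((if i = j then 1 else 0 : ℝ) : ℂ) := by
    rw [key, h2, ← eij]
    have e00' := congrArg (fun x : ℝ => (x : ℂ)) e00
    have e0i' := congrArg (fun x : ℝ => (x : ℂ)) e0i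
    simp only [wedge, sdForm]
    push_cast at e00' e0i' ⊢
    generalize (flat (petrovMetric k) (e 0) 0 p : ℂ) = x0 at *
    generalize (flat (petrovMetric k) (e 0) 1 p : ℂ) = x1 at *
    generalize (flat (petrovMetric k) (e 0) 2 p : ℂ) = x2 at *
    generalize (flat (petrovMetric k) (e 0) 3 p : ℂ) = x3 at *
    generalize (flat (petrovMetric k) (e i.succ) 0 p : ℂ) = y0 at *
    generalize (flat (petrovMetric k) (e i.succ) 1 p : ℂ) = y1 at *
    generalize (flat (petrovMetric k) (e i.succ) 2 p : ℂ) = y2 at *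
    generalize (flat (petrovMetric k) (e i.succ) 3 p : ℂ) = y3 at *
    generalize (flat (petrovMetric k) (e j.succ) 0 p : ℂ) = z0 at *
    generalize (flat (petrovMetric k) (e j.succ) 1 p : ℂ) = z1 at *
    generalize (flat (petrovMetric k) (e j.succ) 2 p : ℂ) = z2 at *
    generalize (flat (petrovMetric k) (e j.succ) 3 p : ℂ) = z3 at *
    generalize (fA p : ℂ) = A at *
    generalize (fC p : ℂ) = C at *
    generalize (fS p : ℂ) = S at *
    -- This is the Gram identity `⟨e_0 ∧ e_i, e_0 ∧ e_j⟩ = ⟨e_0, e_0⟩⟨e_i, e_j⟩ - ⟨e_0, e_i⟩⟨e_0,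
    -- e_j⟩` combined with orthonormality; the last term reconciles the purely `yzt` components
    -- through `A(C² + S²) = 1`.
    linear_combination
      2⁻¹ * (k : ℂ) ^ 2 * (y0 * z0 + (C ^ 2 + S ^ 2) * (y1 * z1) + A * (C * (y2 * z2)
        - S * (y2 * z3 + y3 * z2) - C * (y3 * z3))) * e00'
      - 2⁻¹ * (k : ℂ) ^ 2 * (x0 * z0 + (C ^ 2 + S ^ 2) * (x1 * z1) + A * (C * (x2 * z2)
        - S * (x2 * z3 + x3 * z2) - C * (x3 * z3))) * e0i'
      - 2⁻¹ * (k : ℂ) ^ 4 * ((C * ((x1 * y2 - x2 * y1) * (x1 * z2 - x2 * z1))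
        - S * ((x1 * y2 - x2 * y1) * (x1 * z3 - x3 * z1)
          + (x1 * y3 - x3 * y1) * (x1 * z2 - x2 * z1))
        - C * ((x1 * y3 - x3 * y1) * (x1 * z3 - x3 * z1)))
        - A * ((x2 * y3 - x3 * y2) * (x2 * z3 - x3 * z2))) * hA
  rw [hcast]
  split_ifs <;> simp

/-! ### Eigenvalue types of a principal frame -/

/-- The bivector `F` belongs at `p` to the real eigenvalue `α` of the self-dual Weyl tensor
(`none`) or to one of the two others (`some τ`). -/
def HasEigenType (k : ℝ) (F : Fin 4 → Fin 4 → ℂ) (α : ℂ) : Option ℤˣ → Prop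
  | none => α = -(k : ℂ) ^ 2 ∧ F 0 2 = 0 ∧ F 0 3 = 0 ∧ F 0 1 ≠ 0
  | some τ => α = (k : ℂ) ^ 2 * ((1 - Complex.I * (τ : ℤ) * √3) / 2) ∧
      F 0 1 = 0 ∧ F 0 3 = Complex.I * (τ : ℤ) * F 0 2 ∧ F 0 2 ≠ 0

theorem HasEigenType.im_eq_zero_iff {k : ℝ} (hk : k ≠ 0) {F : Fin 4 → Fin 4 → ℂ} {α : ℂ}
    {t : Option ℤˣ} (h : HasEigenType k F α t) : α.im = 0 ↔ t = none := by
  have him : ((k : ℂ) ^ 2).im = 0 := by rw [← Complex.ofReal_pow]; exact Complex.ofReal_im _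
  have hre : ((k : ℂ) ^ 2).re = k ^ 2 := by rw [← Complex.ofReal_pow]; exact Complex.ofReal_re _
  have h3 : √3 ≠ 0 := (Real.sqrt_pos.2 (by norm_num)).ne'
  cases t with
  | none => simp [h.1, him]
  | some τ =>
    rw [h.1]
    rcases Int.units_eq_one_or τ with h' | h' <;> simp [h', him, hre, hk, h3]

/-- The functions `e^{-2x} (e^x cos(√3 x) - iτ e^x sin(√3 x))`. -/
def nullFactor (τ : ℤˣ) (p : Pt) : ℂ := fA p * (fC p - Complex.I * (τ : ℤ) * fS p)

/-- In closed form `nullFactor τ` is `e^{-(1 + iτ√3)x}`, and it is half the squared length of `dz +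
iτ dt` in the inverse rescaled metric. The two signs give conjugate values. -/
theorem nullFactor_mul (τ : ℤˣ) (p : Pt) : nullFactor τ p * nullFactor (-τ) p = fA p := by
  have hA := fA_mul_complex p
  have hτ := units_sq_complex τ
  unfold nullFactor
  push_cast
  linear_combination (fA p : ℂ) * hA - (fA p : ℂ) ^ 2 * fS p ^ 2 * (Complex.I_sq * ((τ : ℤ) : ℂ) ^ 2 - hτ)

theorem nullFactor_ne_zero (τ : ℤˣ) (p : Pt) : nullFactor τ p ≠ 0 := fun h => by
  have := nullFactor_mul τ p
  rw [h, zero_mul] at this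
  exact (fA_pos p).ne' (by exact_mod_cast this.symm)

theorem sdForm_of_none {k : ℝ} {p : Pt} {F G : Fin 4 → Fin 4 → ℂ} {α β : ℂ}
    (hF : HasEigenType k F α none) (hG : HasEigenType k G β none) :
    sdForm p F G = (fC p ^ 2 + fS p ^ 2) * (F 0 1 * G 0 1) := by
  simp [sdForm, hF.2.1, hF.2.2.1, hG.2.1, hG.2.2.1]

theorem sdForm_of_some {k : ℝ} {p : Pt} {F G : Fin 4 → Fin 4 → ℂ} {α β : ℂ} {τ : ℤˣ}
    (hF : HasEigenType k F α (some τ)) (hG : HasEigenType k G β (some τ)) :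
    sdForm p F G = 2 * nullFactor τ p * (F 0 2 * G 0 2) := by
  have hτ := units_sq_complex τ
  rw [sdForm, hF.2.1, hF.2.2.1, hG.2.2.1, nullFactor]
  linear_combination -(fA p * fC p * (F 0 2 * G 0 2)) * (Complex.I_sq * ((τ : ℤ) : ℂ) ^ 2 - hτ)

/-- Each eigenspace is a line spanned by a non-null bivector, so orthogonal bivectors cannot share a
type. This makes the type map of a frame injective, hence bijective. -/
theorem sdForm_ne_zero {k : ℝ} {p : Pt} {F G : Fin 4 → Fin 4 → ℂ} {α β : ℂ} {t : Option ℤˣ}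
    (hF : HasEigenType k F α t) (hG : HasEigenType k G β t) : sdForm p F G ≠ 0 := by
  cases t with
  | none =>
    rw [sdForm_of_none hF hG]
    refine mul_ne_zero (fun h => ?_) (mul_ne_zero hF.2.2.2 hG.2.2.2)
    have := fA_mul_complex p
    rw [h, mul_zero] at this
    exact zero_ne_one this
  | some τ =>
    rw [sdForm_of_some hF hG]
    exact mul_ne_zero (mul_ne_zero two_ne_zero (nullFactor_ne_zero τ p))
      (mul_ne_zero hF.2.2.2 hG.2.2.2)

/-- The three bivectors of a Weyl principal frame belong to the three eigenvalues. -/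
theorem exists_eigenType {k : ℝ} (hk : k ≠ 0) {σ : ℤˣ} {U : Set Pt} (hU : IsConnected U)
    {e : Fin 4 → Pt → Pt} {α : Fin 3 → Pt → ℂ} (h : IsPrincipalFrame σ (petrovMetric k) U e α) :
    ∃ T : Fin 3 → Option ℤˣ, Function.Bijective T ∧ ∀ i, ∀ p ∈ U,
      HasEigenType k (frameBivector σ (petrovMetric k) e i p) (α i p) (T i) := by
  have hk4 : (k : ℂ) ^ 4 ≠ 0 := by exact_mod_cast pow_ne_zero 4 hk
  have hT : ∀ i, ∃ t : Option ℤˣ, ∀ p ∈ U,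
      HasEigenType k (frameBivector σ (petrovMetric k) e i p) (α i p) t := by
    intro i
    have hne : ∀ p ∈ U, frameBivector σ (petrovMetric k) e i p ≠ 0 := fun p hp h0 => by
      have := sdForm_frameBivector hk σ (h.2 p hp).1 i i
      rw [h0] at this
      simp [sdForm] at this
    rcases eigenbivector_cases hk hU.isPreconnected (contDiffOn_frameBivector hk σ h.1 i) hne
      (fun p _ => frameBivector_eq_sdTab hk σ e i p) (fun p hp => (h.2 p hp).2 i) with h1 | ⟨τ, h1⟩
    · exact ⟨none, h1⟩
    · exact ⟨some τ, h1⟩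
  choose T hT using hT
  refine ⟨T, (Fintype.bijective_iff_injective_and_card T).2 ⟨fun i j hij => ?_, by decide⟩, hT⟩
  obtain ⟨p, hp⟩ := hU.nonempty
  by_contra hne
  have h1 := sdForm_frameBivector hk σ (h.2 p hp).1 i j
  rw [if_neg hne] at h1
  have hj := hT j p hp
  rw [← hij] at hj
  exact mul_ne_zero hk4 (sdForm_ne_zero (hT i p hp) hj) h1

theorem existsUnique_real_eigenvalue {k : ℝ} (hk : k ≠ 0) {σ : ℤˣ} {U : Set Pt}
    (hU : IsConnected U) {e : Fin 4 → Pt → Pt} {α : Fin 3 → Pt → ℂ}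
    (h : IsPrincipalFrame σ (petrovMetric k) U e α) : ∃! i, ∀ p ∈ U, (α i p).im = 0 := by
  obtain ⟨T, hT, hα⟩ := exists_eigenType hk hU h
  obtain ⟨p, hp⟩ := hU.nonempty
  obtain ⟨i, hi⟩ := hT.2 none
  refine ⟨i, fun q hq => ((hα i q hq).im_eq_zero_iff hk).2 hi, fun j hj => ?_⟩
  exact hT.1 ((((hα j p hp).im_eq_zero_iff hk).1 (hj p hp)).trans hi.symm)

theorem isPrincipalBivector_frameBivector {k : ℝ} (hk : k ≠ 0) {σ : ℤˣ} {U : Set Pt}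
    {e : Fin 4 → Pt → Pt} {α : Fin 3 → Pt → ℂ} (h : IsPrincipalFrame σ (petrovMetric k) U e α)
    (i : Fin 3) :
    IsPrincipalBivector σ (petrovMetric k) U (frameBivector σ (petrovMetric k) e i) := by
  refine ⟨contDiffOn_frameBivector hk σ h.1 i, fun p hp => ⟨fun h0 => ?_, fun a b => ?_,
    hodge_of_eq_sdTab hk (frameBivector_eq_sdTab hk σ e i p), α i p, (h.2 p hp).2 i⟩⟩
  · have := sdForm_frameBivector hk σ (h.2 p hp).1 i i
    rw [h0] at this
    simp [sdForm] at this
  · rw [frameBivector_eq_sdTab hk]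
    exact sdTab_antisymm _ _ _ _ _ a b

/-! ### Connection forms of a principal frame -/

/-- The logarithmic derivative of a function with prescribed square. -/
theorem pd_of_mul_sq {U : Set Pt} (hU : IsOpen U) {Z φ : Pt → ℂ} {κ : ℂ}
    (h : ∀ q ∈ U, Z q * φ q ^ 2 = κ) {p : Pt} (hp : p ∈ U) (hZ : DifferentiableAt ℝ Z p)
    (hφ : DifferentiableAt ℝ φ p) {c : Fin 4} {z : ℂ} (hz : pd c Z p = -2 * z * Z p)
    (hZ0 : Z p ≠ 0) (hφ0 : φ p ≠ 0) : pd c φ p = z * φ p := by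
  have h1 : pd c (fun q => Z q * (φ q * φ q) - κ) p = 0 :=
    pd_eq_zero_of_eqOn hU (fun q hq => by rw [← h q hq]; ring) hp c
  rw [pd_sub (hZ.fun_mul (hφ.fun_mul hφ)) (differentiableAt_const κ), pd_mul hZ (hφ.fun_mul hφ),
    pd_mul hφ hφ, hz, show pd c (fun _ => κ) p = 0 by simp [pd]] at h1
  have h2 : Z p * φ p * (pd c φ p - z * φ p) = 0 := by linear_combination h1 / 2
  exact sub_eq_zero.1 ((mul_eq_zero.1 h2).resolve_left (mul_ne_zero hZ0 hφ0))

theorem differentiable_nullFactor (τ : ℤˣ) : Differentiable ℝ (nullFactor τ) := fun p => by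
  have hA := differentiableAt_ofReal (contDiff_fA.differentiable (by simp) p)
  have hC := differentiableAt_ofReal (contDiff_fC.differentiable (by simp) p)
  have hS := differentiableAt_ofReal (contDiff_fS.differentiable (by simp) p)
  exact hA.fun_mul (hC.fun_sub (hS.const_mul _))

theorem pd_nullFactor (τ : ℤˣ) (p : Pt) (c : Fin 4) :
    pd c (nullFactor τ) p =
      -2 * (if c = 0 then (1 + Complex.I * (τ : ℤ) * √3) / 2 else 0) * nullFactor τ p := by
  have dA := contDiff_fA.differentiable (by simp) p
  have dC := contDiff_fC.differentiable (by simp) p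
  have dS := contDiff_fS.differentiable (by simp) p
  have hA := differentiableAt_ofReal dA
  have hC := differentiableAt_ofReal dC
  have hS := differentiableAt_ofReal dS
  have hτ := units_sq_complex τ
  have h : pd c (nullFactor τ) p = _ := pd_mul hA (hC.fun_sub (hS.const_mul _)) c
  rw [h, pd_sub hC (hS.const_mul _), pd_const_mul hS, pd_ofReal dA, pd_ofReal dC, pd_ofReal dS,
    pd_fA, pd_fC, pd_fS, nullFactor]
  split_ifs
  · push_cast
    linear_combination (fA p * √3 * fS p) * (hτ - Complex.I_sq * ((τ : ℤ) : ℂ) ^ 2)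
  · simp

/-- The partial derivatives of the bivectors of a Weyl principal frame. -/
theorem pd_of_hasEigenType_some {k : ℝ} (hk : k ≠ 0) {U : Set Pt} (hU : IsOpen U) {F : TwoTensor}
    {α : Pt → ℂ} {τ : ℤˣ} (hF : ∀ p ∈ U, HasEigenType k (F p) (α p) (some τ))
    (hd : ∀ a b, DifferentiableOn ℝ (fun q => F q a b) U)
    (hn : ∀ p ∈ U, (k : ℂ) ^ 4 * sdForm p (F p) (F p) = -2⁻¹) {p : Pt} (hp : p ∈ U) (c : Fin 4) :
    pd c (fun q => F q 0 1) p = 0 ∧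
    pd c (fun q => F q 0 2) p =
      (if c = 0 then (1 + Complex.I * (τ : ℤ) * √3) / 2 else 0) * F p 0 2 ∧
    pd c (fun q => F q 0 3) p = Complex.I * (τ : ℤ) *
      ((if c = 0 then (1 + Complex.I * (τ : ℤ) * √3) / 2 else 0) * F p 0 2) := by
  have hk4 : (k : ℂ) ^ 4 ≠ 0 := by exact_mod_cast pow_ne_zero 4 hk
  have dF : ∀ a b, DifferentiableAt ℝ (fun q => F q a b) p := fun a b =>
    (hd a b p hp).differentiableAt (hU.mem_nhds hp)
  have h2 : pd c (fun q => F q 0 2) p =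
      (if c = 0 then (1 + Complex.I * (τ : ℤ) * √3) / 2 else 0) * F p 0 2 := by
    -- The normalization reads `2 k⁴ · nullFactor τ · F_xz² = -1/2`, whence the constant. Thus
    -- `F_xz` is a constant times `e^{(1 + iτ√3)x/2}`.
    refine pd_of_mul_sq hU (Z := nullFactor τ) (κ := -4⁻¹ / (k : ℂ) ^ 4) (fun q hq => ?_) hp
      (differentiable_nullFactor τ p) (dF 0 2) (pd_nullFactor τ p c) (nullFactor_ne_zero τ p)
      (hF p hp).2.2.2
    have := hn q hq
    rw [sdForm_of_some (hF q hq) (hF q hq)] at this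
    rw [eq_div_iff hk4]
    linear_combination this / 2
  refine ⟨pd_eq_zero_of_eqOn hU (fun q hq => (hF q hq).2.1) hp c, h2, ?_⟩
  rw [pd_congr (Filter.eventually_of_mem (hU.mem_nhds hp) fun q hq => (hF q hq).2.2.1),
    pd_const_mul (dF 0 2), h2]

theorem pd_of_hasEigenType_none {k : ℝ} (hk : k ≠ 0) {U : Set Pt} (hU : IsOpen U) {F : TwoTensor}
    {α : Pt → ℂ} (hF : ∀ p ∈ U, HasEigenType k (F p) (α p) none)
    (hd : ∀ a b, DifferentiableOn ℝ (fun q => F q a b) U)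
    (hn : ∀ p ∈ U, (k : ℂ) ^ 4 * sdForm p (F p) (F p) = -2⁻¹) {p : Pt} (hp : p ∈ U) (c : Fin 4) :
    pd c (fun q => F q 0 1) p = (if c = 0 then -1 else 0) * F p 0 1 ∧
    pd c (fun q => F q 0 2) p = 0 ∧ pd c (fun q => F q 0 3) p = 0 := by
  have hk4 : (k : ℂ) ^ 4 ≠ 0 := by exact_mod_cast pow_ne_zero 4 hk
  have dC := contDiff_fC.differentiable (by simp) p
  have dS := contDiff_fS.differentiable (by simp) p
  have hC := differentiableAt_ofReal dC
  have hS := differentiableAt_ofReal dS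
  refine ⟨?_, pd_eq_zero_of_eqOn hU (fun q hq => (hF q hq).2.1) hp c,
    pd_eq_zero_of_eqOn hU (fun q hq => (hF q hq).2.2.1) hp c⟩
  refine pd_of_mul_sq hU (Z := fun q => (fC q : ℂ) * fC q + (fS q : ℂ) * fS q)
    (κ := -2⁻¹ / (k : ℂ) ^ 4) (fun q hq => ?_) hp
    ((hC.fun_mul hC).fun_add (hS.fun_mul hS)) ((hd 0 1 p hp).differentiableAt (hU.mem_nhds hp))
    ?_ (fun h => ?_) (hF p hp).2.2.2
  · have := hn q hq
    rw [sdForm_of_none (hF q hq) (hF q hq)] at this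
    rw [eq_div_iff hk4]
    linear_combination this
  · rw [pd_add (hC.fun_mul hC) (hS.fun_mul hS), pd_mul hC hC, pd_mul hS hS, pd_ofReal dC,
      pd_ofReal dS, pd_fC, pd_fS]
    split_ifs
    · push_cast
      ring
    · simp
  · have := fA_mul_complex p
    rw [show (fC p : ℂ) ^ 2 + (fS p : ℂ) ^ 2 = 0 by linear_combination h, mul_zero] at this
    exact zero_ne_one this

theorem nullFactor_mul_sq {k : ℝ} (hk : k ≠ 0) {p : Pt} {F : Fin 4 → Fin 4 → ℂ} {α : ℂ} {τ : ℤˣ}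
    (hF : HasEigenType k F α (some τ)) (hn : (k : ℂ) ^ 4 * sdForm p F F = -2⁻¹) :
    nullFactor τ p * F 0 2 ^ 2 = -4⁻¹ / (k : ℂ) ^ 4 := by
  have hk4 : (k : ℂ) ^ 4 ≠ 0 := by exact_mod_cast pow_ne_zero 4 hk
  rw [sdForm_of_some hF hF] at hn
  rw [eq_div_iff hk4]
  linear_combination hn / 2

/-- The covariant derivative of a bivector of a Weyl principal frame that belongs to a complex
eigenvalue. -/
theorem covDeriv_of_hasEigenType_some {k : ℝ} (hk : k ≠ 0) {σ : ℤˣ} {U : Set Pt} (hU : IsOpen U)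
    {F : TwoTensor} {α : Pt → ℂ} {τ : ℤˣ} (hF : ∀ p ∈ U, HasEigenType k (F p) (α p) (some τ))
    (hs : ∀ p ∈ U, F p = sdTab σ p (F p 0 1) (F p 0 2) (F p 0 3))
    (hd : ∀ a b, DifferentiableOn ℝ (fun q => F q a b) U)
    (hn : ∀ p ∈ U, (k : ℂ) ^ 4 * sdForm p (F p) (F p) = -2⁻¹) {p : Pt} (hp : p ∈ U)
    (c a b : Fin 4) :
    covDeriv (petrovMetric k) F c a b p = sdTab σ p
      (Complex.I * (σ : ℤ) * (-4⁻¹ / (k : ℂ) ^ 4) / F p 0 2 *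
        ![0, 0, Complex.I * (τ : ℤ) / 2 + √3 / 2, -(√3 / 2 * (Complex.I * (τ : ℤ))) + 1 / 2] c)
      (Complex.I * (σ : ℤ) * (-4⁻¹ / (k : ℂ) ^ 4) / F p 0 2 *
        ![0, Complex.I * (τ : ℤ), 0, 0] c)
      (Complex.I * (σ : ℤ) * (-4⁻¹ / (k : ℂ) ^ 4) / F p 0 2 * ![0, 1, 0, 0] c) a b := by
  obtain ⟨h1, h2, h3⟩ := pd_of_hasEigenType_some hk hU hF hd hn hp c
  obtain ⟨-, f1, f3, f2⟩ := hF p hp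
  have hκ := nullFactor_mul_sq hk (hF p hp) (hn p hp)
  obtain ⟨t, ht, htt⟩ : ∃ t : ℂ, Complex.I * (τ : ℤ) = t ∧ t ^ 2 = -1 :=
    ⟨_, rfl, by rw [mul_pow, Complex.I_sq, units_sq_complex, mul_one]⟩
  rw [covDeriv_eq_sdTab hk hU hs hd hp, h1, h2, h3, f3, f1, ht, ← hκ, nullFactor, ht]
  have e12 : sdTab σ p 0 (F p 0 2) (t * F p 0 2) 1 2 =
      Complex.I * (σ : ℤ) * (fA p * (fC p - t * fS p) * F p 0 2) * t := by
    simp only [sdTab]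
    simp
    linear_combination (Complex.I * (σ : ℤ) * fA p * fS p * F p 0 2) * htt
  have e13 : sdTab σ p 0 (F p 0 2) (t * F p 0 2) 1 3 =
      Complex.I * (σ : ℤ) * (fA p * (fC p - t * fS p) * F p 0 2) := by
    simp only [sdTab]
    simp
    ring
  have e23 : sdTab σ p 0 (F p 0 2) (t * F p 0 2) 2 3 = 0 := by
    simp [sdTab]
  have hdiv : Complex.I * (σ : ℤ) * (fA p * (fC p - t * fS p) * F p 0 2 ^ 2) / F p 0 2 =
      Complex.I * (σ : ℤ) * (fA p * (fC p - t * fS p) * F p 0 2) := by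
    field_simp
  rw [hdiv]
  simp only [covTabU, covTabV, covTabW, e12, e13, e23]
  generalize Complex.I * (σ : ℤ) * (fA p * (fC p - t * fS p) * F p 0 2) = z
  generalize F p 0 2 = v
  congr 1
  · fin_cases c <;> simp <;> ring
  · fin_cases c <;> simp
    ring
  · fin_cases c <;> simp
    linear_combination (√3 / 2 * v) * htt

/-- The covariant derivative of a bivector of a Weyl principal frame that belongs to the real
eigenvalue. -/
theorem covDeriv_of_hasEigenType_none {k : ℝ} (hk : k ≠ 0) {σ : ℤˣ} {U : Set Pt} (hU : IsOpen U)
    {F : TwoTensor} {α : Pt → ℂ} (hF : ∀ p ∈ U, HasEigenType k (F p) (α p) none)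
    (hs : ∀ p ∈ U, F p = sdTab σ p (F p 0 1) (F p 0 2) (F p 0 3))
    (hd : ∀ a b, DifferentiableOn ℝ (fun q => F q a b) U)
    (hn : ∀ p ∈ U, (k : ℂ) ^ 4 * sdForm p (F p) (F p) = -2⁻¹) {p : Pt} (hp : p ∈ U)
    (c a b : Fin 4) :
    covDeriv (petrovMetric k) F c a b p = sdTab σ p 0
      (Complex.I * (σ : ℤ) * (-4⁻¹ / (k : ℂ) ^ 4) / F p 0 1 * ![0, 0, -√3, -1] c)
      (Complex.I * (σ : ℤ) * (-4⁻¹ / (k : ℂ) ^ 4) / F p 0 1 * ![0, 0, 1, -√3] c) a b := by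
  have hk4 : (k : ℂ) ^ 4 ≠ 0 := by exact_mod_cast pow_ne_zero 4 hk
  obtain ⟨h1, h2, h3⟩ := pd_of_hasEigenType_none hk hU hF hd hn hp c
  have hκ := hn p hp
  rw [sdForm_of_none (hF p hp) (hF p hp)] at hκ
  obtain ⟨-, f2, f3, f1⟩ := hF p hp
  rw [covDeriv_eq_sdTab hk hU hs hd hp, h1, h2, h3, f3, f2]
  have e12 : sdTab σ p (F p 0 1) 0 0 1 2 = 0 := by simp [sdTab]
  have e13 : sdTab σ p (F p 0 1) 0 0 1 3 = 0 := by simp [sdTab]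
  have e23 : sdTab σ p (F p 0 1) 0 0 2 3 =
      -(2 * (Complex.I * (σ : ℤ) * (-4⁻¹ / (k : ℂ) ^ 4) / F p 0 1)) := by
    have h : (fC p ^ 2 + fS p ^ 2) * F p 0 1 = 2 * (-4⁻¹ / (k : ℂ) ^ 4) / F p 0 1 := by
      rw [eq_div_iff f1, mul_div_assoc', eq_div_iff hk4]
      linear_combination hκ
    simp only [sdTab]
    simp only [Matrix.of_apply, Matrix.cons_val]
    linear_combination -(Complex.I * (σ : ℤ)) * h
  simp only [covTabU, covTabV, covTabW, e12, e13, e23]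
  generalize Complex.I * (σ : ℤ) * (-4⁻¹ / (k : ℂ) ^ 4) / F p 0 1 = z
  generalize F p 0 1 = v
  congr 1
  · fin_cases c <;> simp
  · fin_cases c <;> simp <;> ring
  · fin_cases c <;> simp <;> ring

theorem sdTab_linear (σ : ℤˣ) (p : Pt) (x y u v w u' v' w' : ℂ) (a b : Fin 4) :
    x * sdTab σ p u v w a b + y * sdTab σ p u' v' w' a b =
      sdTab σ p (x * u + y * u') (x * v + y * v') (x * w + y * w') a b := by
  fin_cases a <;> fin_cases b <;> simp [sdTab] <;> ring

/-- The connection 1-forms of a Weyl principal frame whose third eigenvalue is real, where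
`u`, `v`, `w` are the components `(𝒰_3)_{xy}`, `(𝒰_1)_{xz}`, `(𝒰_2)_{xz}`. -/
def connectionTab (κ t u v w : ℂ) (c : Fin 4) : Matrix (Fin 3) (Fin 3) ℂ :=
  !![0, κ * t / (v * w) * ![0, 1, 0, 0] c,
      κ / (v * u) * ![0, 0, t / 2 + √3 / 2, -(√3 / 2 * t) + 1 / 2] c;
     -(κ * t / (v * w) * ![0, 1, 0, 0] c), 0,
      κ / (w * u) * ![0, 0, -t / 2 + √3 / 2, -(√3 / 2 * -t) + 1 / 2] c;
     -(κ / (v * u) * ![0, 0, t / 2 + √3 / 2, -(√3 / 2 * t) + 1 / 2] c),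
      -(κ / (w * u) * ![0, 0, -t / 2 + √3 / 2, -(√3 / 2 * -t) + 1 / 2] c), 0]

/-- The bivectors of a Weyl principal frame whose third eigenvalue is real. -/
theorem exists_eigenType_of_real {k : ℝ} (hk : k ≠ 0) {σ : ℤˣ} {U : Set Pt} (hU : IsConnected U)
    {e : Fin 4 → Pt → Pt} {α : Fin 3 → Pt → ℂ} (h : IsPrincipalFrame σ (petrovMetric k) U e α)
    (hα : ∀ p ∈ U, (α 2 p).im = 0) : ∃ τ : ℤˣ,
      (∀ p ∈ U, HasEigenType k (frameBivector σ (petrovMetric k) e 0 p) (α 0 p) (some τ)) ∧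
      (∀ p ∈ U, HasEigenType k (frameBivector σ (petrovMetric k) e 1 p) (α 1 p) (some (-τ))) ∧
      ∀ p ∈ U, HasEigenType k (frameBivector σ (petrovMetric k) e 2 p) (α 2 p) none := by
  obtain ⟨T, hT, hF⟩ := exists_eigenType hk hU h
  obtain ⟨p, hp⟩ := hU.nonempty
  have h2 : T 2 = none := ((hF 2 p hp).im_eq_zero_iff hk).1 (hα p hp)
  have h02 : T 0 ≠ T 2 := hT.1.ne (by decide)
  have h12 : T 1 ≠ T 2 := hT.1.ne (by decide)
  have h01 : T 0 ≠ T 1 := hT.1.ne (by decide)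
  rw [h2] at h02 h12
  obtain ⟨τ, hτ⟩ := Option.ne_none_iff_exists'.1 h02
  obtain ⟨τ', hτ'⟩ := Option.ne_none_iff_exists'.1 h12
  rw [hτ, hτ'] at h01
  have hττ : τ' = -τ := by
    have : τ ≠ τ' := fun h => h01 (by rw [h])
    rcases Int.units_eq_one_or τ with h | h <;> rcases Int.units_eq_one_or τ' with h' | h' <;>
      simp_all
  refine ⟨τ, fun p hp => hτ ▸ hF 0 p hp, fun p hp => ?_, fun p hp => h2 ▸ hF 2 p hp⟩
  have := hF 1 p hp
  rwa [hτ', hττ] at this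

/-- The connection of a Weyl principal frame whose third eigenvalue is real. -/
theorem covDeriv_frameBivector {k : ℝ} (hk : k ≠ 0) {σ : ℤˣ} {U : Set Pt} (hUo : IsOpen U)
    {e : Fin 4 → Pt → Pt} {α : Fin 3 → Pt → ℂ}
    (h : IsPrincipalFrame σ (petrovMetric k) U e α) {τ : ℤˣ}
    (h0 : ∀ p ∈ U, HasEigenType k (frameBivector σ (petrovMetric k) e 0 p) (α 0 p) (some τ))
    (h1 : ∀ p ∈ U, HasEigenType k (frameBivector σ (petrovMetric k) e 1 p) (α 1 p) (some (-τ)))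
    (h2 : ∀ p ∈ U, HasEigenType k (frameBivector σ (petrovMetric k) e 2 p) (α 2 p) none)
    {p : Pt} (hp : p ∈ U) (i : Fin 3) (c a b : Fin 4) :
    covDeriv (petrovMetric k) (frameBivector σ (petrovMetric k) e i) c a b p =
      ∑ j, connectionTab (Complex.I * (σ : ℤ) * (-4⁻¹ / (k : ℂ) ^ 4)) (Complex.I * (τ : ℤ))
        (frameBivector σ (petrovMetric k) e 2 p 0 1) (frameBivector σ (petrovMetric k) e 0 p 0 2)
        (frameBivector σ (petrovMetric k) e 1 p 0 2) c i j *
        frameBivector σ (petrovMetric k) e j p a b := by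
  have hs := fun i => fun p (_ : p ∈ U) => frameBivector_eq_sdTab hk σ e i p
  have hd : ∀ i a b, DifferentiableOn ℝ (fun q => frameBivector σ (petrovMetric k) e i q a b) U :=
    fun i a b => (contDiffOn_pi.1 (contDiffOn_pi.1 (contDiffOn_frameBivector hk σ h.1 i) a)
      b).differentiableOn (by simp)
  have hn : ∀ i, ∀ p ∈ U, (k : ℂ) ^ 4 * sdForm p (frameBivector σ (petrovMetric k) e i p)
      (frameBivector σ (petrovMetric k) e i p) = -2⁻¹ := fun i p hp => by
    rw [sdForm_frameBivector hk σ (h.2 p hp).1, if_pos rfl]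
  have c0 := covDeriv_of_hasEigenType_some hk hUo h0 (hs 0) (hd 0) (hn 0) hp c a b
  have c1 := covDeriv_of_hasEigenType_some hk hUo h1 (hs 1) (hd 1) (hn 1) hp c a b
  have c2 := covDeriv_of_hasEigenType_none hk hUo h2 (hs 2) (hd 2) (hn 2) hp c a b
  obtain ⟨-, u0, w0, v0⟩ := h0 p hp
  obtain ⟨-, u1, w1, v1⟩ := h1 p hp
  obtain ⟨-, v2, w2, u2⟩ := h2 p hp
  have s0 := congrFun (congrFun (hs 0 p hp) a) b
  have s1 := congrFun (congrFun (hs 1 p hp) a) b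
  have s2 := congrFun (congrFun (hs 2 p hp) a) b
  rw [u0, w0] at s0
  rw [u1, w1] at s1
  rw [v2, w2] at s2
  push_cast at c1 s1
  obtain ⟨t, ht, htt⟩ : ∃ t : ℂ, Complex.I * (τ : ℤ) = t ∧ t ^ 2 = -1 :=
    ⟨_, rfl, by rw [mul_pow, Complex.I_sq, units_sq_complex, mul_one]⟩
  simp only [mul_neg Complex.I, ht] at *
  -- Both sides are self-dual, so it is enough to compare their `xy`, `xz` and `xt` components.
  rw [Fin.sum_univ_three, s0, s1, s2]
  generalize frameBivector σ (petrovMetric k) e 0 p 0 2 = v at *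
  generalize frameBivector σ (petrovMetric k) e 1 p 0 2 = w at *
  generalize frameBivector σ (petrovMetric k) e 2 p 0 1 = u at *
  generalize Complex.I * ((σ : ℤ) : ℂ) * (-4⁻¹ / (k : ℂ) ^ 4) = κ at *
  fin_cases i
  · refine c0.trans ?_
    simp only [connectionTab]
    simp only [Fin.zero_eta, Matrix.of_apply, Matrix.cons_val, zero_mul, zero_add]
    rw [sdTab_linear]
    congr 1 <;> fin_cases c <;> simp <;> field_simp
    rw [htt]
    ring
  · refine c1.trans ?_
    simp only [connectionTab]
    simp only [Fin.mk_one, Matrix.of_apply, Matrix.cons_val, zero_mul, add_zero]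
    rw [sdTab_linear]
    congr 1 <;> fin_cases c <;> simp <;> field_simp
    rw [htt]
    ring
  · refine c2.trans ?_
    simp only [connectionTab]
    simp only [Fin.reduceFinMk, Matrix.of_apply, Matrix.cons_val, zero_mul, add_zero]
    rw [sdTab_linear]
    congr 1 <;> fin_cases c <;> simp <;> field_simp
    · ring
    · ring
    · linear_combination 2 * κ * htt
    · linear_combination -2 * κ * √3 * htt

/-! ### An explicit principal frame -/

theorem weylMap_of_complex {k : ℝ} (hk : k ≠ 0) {σ : ℤˣ} {F : TwoTensor} {p : Pt} {u v w : ℂ}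
    {τ : ℤˣ} (hF : F p = sdTab σ p u v w) (hu : u = 0) (hw : w = Complex.I * (τ : ℤ) * v) :
    weylMap σ (petrovMetric k) F p =
      ((k : ℂ) ^ 2 * ((1 - Complex.I * (τ : ℤ) * √3) / 2)) • F p := by
  have hτ := units_sq_complex τ
  have key : (k : ℂ) ^ 2 • sdTab σ p (-u) ((v - √3 * w) / 2) ((√3 * v + w) / 2) =
      ((k : ℂ) ^ 2 * ((1 - Complex.I * (τ : ℤ) * √3) / 2)) • sdTab σ p u v w := by
    rw [← sdTab_smul, ← sdTab_smul, hu, hw]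
    congr 1
    · simp
    · ring
    · linear_combination (k ^ 2 * √3 / 2 * v) * (Complex.I_sq * ((τ : ℤ) : ℂ) ^ 2 - hτ)
  rw [hF]
  exact (weylMap_sdTab hk hF).trans key

theorem weylMap_of_real {k : ℝ} (hk : k ≠ 0) {σ : ℤˣ} {F : TwoTensor} {p : Pt} {u v w : ℂ}
    (hF : F p = sdTab σ p u v w) (hv : v = 0) (hw : w = 0) :
    weylMap σ (petrovMetric k) F p = (-(k : ℂ) ^ 2) • F p := by
  have key : (k : ℂ) ^ 2 • sdTab σ p (-u) ((v - √3 * w) / 2) ((√3 * v + w) / 2) =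
      (-(k : ℂ) ^ 2) • sdTab σ p u v w := by
    rw [← sdTab_smul, ← sdTab_smul, hv, hw]
    congr 1 <;> ring
  rw [hF]
  exact (weylMap_sdTab hk hF).trans key

/-- The real part of the null direction `e^{(1 + i√3)x/2}`. -/
def halfC (p : Pt) : ℝ := Real.exp (p 0 / 2) * Real.cos (√3 * p 0 / 2)

/-- The imaginary part of the null direction `e^{(1 + i√3)x/2}`. -/
def halfS (p : Pt) : ℝ := Real.exp (p 0 / 2) * Real.sin (√3 * p 0 / 2)

theorem exp_half_sq (x : ℝ) : Real.exp (x / 2) ^ 2 = Real.exp x := by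
  rw [pow_two, ← Real.exp_add]; ring_nf

/-- With the next lemma this says that `halfC + i·halfS` is a square root of `fC + i·fS`. -/
theorem fC_eq_half (p : Pt) : fC p = halfC p ^ 2 - halfS p ^ 2 := by
  rw [fC, halfC, halfS, mul_pow, mul_pow, exp_half_sq, ← mul_sub, ← Real.cos_two_mul']
  ring_nf

theorem fS_eq_half (p : Pt) : fS p = 2 * halfC p * halfS p := by
  have : √3 * p 0 = 2 * (√3 * p 0 / 2) := by ring
  rw [fS, halfC, halfS, ← exp_half_sq, this, Real.sin_two_mul]
  ring_nf

theorem exp_neg_mul_half (p : Pt) : Real.exp (-p 0) * (halfC p ^ 2 + halfS p ^ 2) = 1 := by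
  rw [halfC, halfS, mul_pow, mul_pow, exp_half_sq, ← mul_add, Real.cos_sq_add_sin_sq, mul_one,
    ← Real.exp_add, neg_add_cancel, Real.exp_zero]

theorem fA_eq_exp_neg_sq (p : Pt) : fA p = Real.exp (-p 0) ^ 2 := by
  rw [fA, pow_two, ← Real.exp_add]; ring_nf

/-- A Weyl principal frame of the Petrov metric. -/
def petrovFrame (k : ℝ) : Fin 4 → Pt → Pt :=
  ![fun p => ![0, 0, k * Real.exp (-p 0) * halfS p, k * Real.exp (-p 0) * halfC p],
    fun p => ![k / √2, k / √2 * Real.exp (p 0), 0, 0],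
    fun p => ![k / √2, -(k / √2 * Real.exp (p 0)), 0, 0],
    fun p => ![0, 0, k * Real.exp (-p 0) * halfC p, -(k * Real.exp (-p 0) * halfS p)]]

/-- The coframe of `petrovFrame`. -/
def petrovCoframe (k : ℝ) (p : Pt) : Matrix (Fin 4) (Fin 4) ℝ :=
  !![0, 0, -(k⁻¹ * halfS p), -(k⁻¹ * halfC p);
     k⁻¹ / √2, k⁻¹ / √2 * Real.exp (-p 0), 0, 0;
     k⁻¹ / √2, -(k⁻¹ / √2 * Real.exp (-p 0)), 0, 0;
     0, 0, k⁻¹ * halfC p, -(k⁻¹ * halfS p)]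

/-- The `zt` block of the rescaled metric is `Re θ² = (Re θ)² - (Im θ)²` with `θ = (halfC +
i·halfS)(dz + i dt)`. Up to `k⁻¹`, `e_3` is dual to `Re θ` and `e_0` to `-Im θ`, while `e_1` and
`e_2` come from `dx` and `e^{-x} dy` by a turn of 45 degrees (with a reflection), which makes `𝒰_1`
and `𝒰_2` eigenbivectors. -/
theorem flat_petrovFrame {k : ℝ} (hk : k ≠ 0) (m a : Fin 4) (p : Pt) :
    flat (petrovMetric k) (petrovFrame k m) a p = petrovCoframe k p m a := by
  have hρ := exp_neg_mul_half p
  have hr : Real.exp (-p 0) * Real.exp (p 0) = 1 := by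
    rw [← Real.exp_add, neg_add_cancel, Real.exp_zero]
  have hkk : (k ^ 2)⁻¹ * k = k⁻¹ := by field_simp
  have aux : ∀ a : Fin 4, flat (petrovMetric k) (petrovFrame k m) a p = ![
      (k ^ 2)⁻¹ * petrovFrame k m p 0, (k ^ 2)⁻¹ * (fA p * petrovFrame k m p 1),
      (k ^ 2)⁻¹ * (fC p * petrovFrame k m p 2 - fS p * petrovFrame k m p 3),
      -((k ^ 2)⁻¹ * (fS p * petrovFrame k m p 2 + fC p * petrovFrame k m p 3))] a := by
    obtain ⟨h0, h1, h2, h3⟩ := flat_eq k (petrovFrame k m) p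
    intro a
    fin_cases a
    exacts [h0, h1, h2, h3]
  rw [aux, fC_eq_half, fS_eq_half, fA_eq_exp_neg_sq]
  fin_cases m <;> fin_cases a <;> simp [petrovFrame, petrovCoframe]
  · linear_combination -halfS p * ((k ^ 2)⁻¹ * k * hρ + hkk)
  · linear_combination halfC p * ((k ^ 2)⁻¹ * k * hρ + hkk)
  · linear_combination hkk / √2
  · linear_combination Real.exp (-p 0) / √2 * ((k ^ 2)⁻¹ * k * hr + hkk)
  · linear_combination hkk / √2
  · linear_combination Real.exp (-p 0) / √2 * ((k ^ 2)⁻¹ * k * hr + hkk)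
  · linear_combination halfC p * ((k ^ 2)⁻¹ * k * hρ + hkk)
  · linear_combination halfS p * ((k ^ 2)⁻¹ * k * hρ + hkk)

theorem petrovFrame_orthonormal {k : ℝ} (hk : k ≠ 0) (p : Pt) (m n : Fin 4) :
    ∑ a, flat (petrovMetric k) (petrovFrame k m) a p * petrovFrame k n p a =
      if m = n then (if m = 0 then -1 else 1) else 0 := by
  have hρ := exp_neg_mul_half p
  have hr : Real.exp (-p 0) * Real.exp (p 0) = 1 := by
    rw [← Real.exp_add, neg_add_cancel, Real.exp_zero]
  have hkk : k⁻¹ * k = 1 := inv_mul_cancel₀ hk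
  have h2 : (√2)⁻¹ ^ 2 = 2⁻¹ := by rw [inv_pow, Real.sq_sqrt (by norm_num)]
  simp only [flat_petrovFrame hk, Fin.sum_univ_four]
  have a1 : k⁻¹ / √2 * (k / √2) = 2⁻¹ := by
    linear_combination (√2)⁻¹ ^ 2 * hkk + h2
  have a2 : ∀ ρ r : ℝ, ρ * r = 1 → k⁻¹ / √2 * ρ * (k / √2 * r) = 2⁻¹ := fun ρ r h => by
    linear_combination ρ * r * a1 + 2⁻¹ * h
  fin_cases m <;> fin_cases n <;> simp [petrovFrame, petrovCoframe]
  · linear_combination -(k⁻¹ * k) * hρ - hkk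
  · ring
  · linear_combination a1 + a2 _ _ hr
  · linear_combination a1 - a2 _ _ hr
  · linear_combination a1 - a2 _ _ hr
  · linear_combination a1 + a2 _ _ hr
  · ring
  · linear_combination k⁻¹ * k * hρ + hkk

theorem contDiff_petrovFrame (k : ℝ) (m : Fin 4) : ContDiff ℝ ∞ (petrovFrame k m) := by
  have hC : ContDiff ℝ ∞ halfC := by unfold halfC; fun_prop
  have hS : ContDiff ℝ ∞ halfS := by unfold halfS; fun_prop
  refine contDiff_pi.2 fun a => ?_
  fin_cases m <;> fin_cases a <;> simp [petrovFrame] <;> fun_prop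

/-- The bivectors of `petrovFrame`. -/
theorem frameBivector_petrovFrame {k : ℝ} (hk : k ≠ 0) (σ : ℤˣ) (p : Pt) :
    (frameBivector σ (petrovMetric k) (petrovFrame k) 0 p 0 1 = 0 ∧
      frameBivector σ (petrovMetric k) (petrovFrame k) 0 p 0 3 =
        Complex.I * (σ : ℤ) * frameBivector σ (petrovMetric k) (petrovFrame k) 0 p 0 2) ∧
    (frameBivector σ (petrovMetric k) (petrovFrame k) 1 p 0 1 = 0 ∧
      frameBivector σ (petrovMetric k) (petrovFrame k) 1 p 0 3 = Complex.I * ((-σ : ℤˣ) : ℤ) *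
        frameBivector σ (petrovMetric k) (petrovFrame k) 1 p 0 2) ∧
    frameBivector σ (petrovMetric k) (petrovFrame k) 2 p 0 2 = 0 ∧
      frameBivector σ (petrovMetric k) (petrovFrame k) 2 p 0 3 = 0 := by
  have hσ := units_sq_complex σ
  have hρ : Complex.exp (-(p 0 : ℂ)) * ((halfC p : ℂ) ^ 2 + (halfS p : ℂ) ^ 2) = 1 := by
    exact_mod_cast exp_neg_mul_half p
  have hC : (fC p : ℂ) = (halfC p : ℂ) ^ 2 - (halfS p : ℂ) ^ 2 := by
    exact_mod_cast fC_eq_half p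
  have hS : (fS p : ℂ) = 2 * (halfC p : ℂ) * (halfS p : ℂ) := by
    exact_mod_cast fS_eq_half p
  simp only [frameBivector_apply hk, hodgeTab, wedge, flat_petrovFrame hk, petrovCoframe, hC, hS]
  refine ⟨⟨?_, ?_⟩, ⟨?_, ?_⟩, ?_, ?_⟩ <;> simp
  · linear_combination (((√2 : ℝ) : ℂ)⁻¹ ^ 2 * (k : ℂ)⁻¹ ^ 2) * (Complex.I * (σ : ℤ) * halfS p * hρ
      + halfC p * (Complex.I ^ 2 * ((σ : ℤ) : ℂ) ^ 2 * hρ + ((σ : ℤ) : ℂ) ^ 2 * Complex.I_sq - hσ))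
  · linear_combination (((√2 : ℝ) : ℂ)⁻¹ ^ 2 * (k : ℂ)⁻¹ ^ 2) * (-Complex.I * (σ : ℤ) * halfS p * hρ
      + halfC p * (Complex.I ^ 2 * ((σ : ℤ) : ℂ) ^ 2 * hρ + ((σ : ℤ) : ℂ) ^ 2 * Complex.I_sq - hσ))

/-- The Weyl eigenvalues of `petrovFrame`. -/
def petrovEigenvalue (k : ℝ) (σ : ℤˣ) : Fin 3 → Pt → ℂ :=
  ![fun _ => (k : ℂ) ^ 2 * ((1 - Complex.I * (σ : ℤ) * √3) / 2),
    fun _ => (k : ℂ) ^ 2 * ((1 - Complex.I * ((-σ : ℤˣ) : ℤ) * √3) / 2),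
    fun _ => -(k : ℂ) ^ 2]

theorem isPrincipalFrame_petrovFrame {k : ℝ} (hk : k ≠ 0) (σ : ℤˣ) (U : Set Pt) :
    IsPrincipalFrame σ (petrovMetric k) U (petrovFrame k) (petrovEigenvalue k σ) := by
  refine ⟨fun m => (contDiff_petrovFrame k m).contDiffOn,
    fun p _ => ⟨petrovFrame_orthonormal hk p, fun i => ?_⟩⟩
  obtain ⟨⟨h01, h03⟩, ⟨h11, h13⟩, h22, h23⟩ := frameBivector_petrovFrame hk σ p
  have hs := fun i => frameBivector_eq_sdTab hk σ (petrovFrame k) i p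
  fin_cases i
  · exact weylMap_of_complex hk (hs 0) h01 h03
  · exact weylMap_of_complex hk (hs 1) h11 h13
  · exact weylMap_of_real hk (hs 2) h22 h23

/-! ### Consequences for arbitrary principal frames -/

theorem injective_of_isPrincipalFrame {k : ℝ} (hk : k ≠ 0) {σ : ℤˣ} {U : Set Pt}
    (hU : IsConnected U) {e : Fin 4 → Pt → Pt} {α : Fin 3 → Pt → ℂ}
    (h : IsPrincipalFrame σ (petrovMetric k) U e α) {p : Pt} (hp : p ∈ U) :
    Function.Injective fun i => α i p := by
  obtain ⟨T, hT, hα⟩ := exists_eigenType hk hU h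
  have hk2 : (k : ℂ) ^ 2 ≠ 0 := by exact_mod_cast pow_ne_zero 2 hk
  intro i j hij
  apply hT.1
  have hi := hα i p hp
  have hj := hα j p hp
  have h1 := hi.im_eq_zero_iff hk
  have h2 := hj.im_eq_zero_iff hk
  simp only at hij
  rw [hij, h2] at h1
  cases hti : T i with
  | none => exact (h1.2 hti).symm
  | some τ =>
    cases htj : T j with
    | none => rw [h1.1 htj] at hti; exact hti.symm
    | some τ' =>
      rw [hti] at hi
      rw [htj] at hj
      have h3 := mul_left_cancel₀ hk2 (hi.1.symm.trans (hij.trans hj.1))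
      have h4 : Complex.I * √3 * (((τ : ℤ) : ℂ) - (τ' : ℤ)) = 0 := by
        linear_combination -2 * h3
      have h5 := (mul_eq_zero.1 h4).resolve_left
        (mul_ne_zero Complex.I_ne_zero sqrt_three_ne_zero_complex)
      have h6 : (τ : ℤ) = τ' := by exact_mod_cast sub_eq_zero.1 h5
      rw [Units.ext h6]

theorem connectionTab_antisymm (κ t u v w : ℂ) (c : Fin 4) (i j : Fin 3) :
    connectionTab κ t u v w c i j = -connectionTab κ t u v w c j i := by
  fin_cases i <;> fin_cases j <;> simp [connectionTab]

theorem exists_isConnection {k : ℝ} (hk : k ≠ 0) {σ : ℤˣ} {U : Set Pt} (hUo : IsOpen U)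
    (hU : IsConnected U) {e : Fin 4 → Pt → Pt} {α : Fin 3 → Pt → ℂ}
    (h : IsPrincipalFrame σ (petrovMetric k) U e α) (hα : ∀ p ∈ U, (α 2 p).im = 0) :
    ∃ Γ, IsConnection (petrovMetric k) U (frameBivector σ (petrovMetric k) e) Γ := by
  obtain ⟨τ, h0, h1, h2⟩ := exists_eigenType_of_real hk hU h hα
  exact ⟨fun i j p c => connectionTab (Complex.I * (σ : ℤ) * (-4⁻¹ / (k : ℂ) ^ 4))
      (Complex.I * (τ : ℤ)) (frameBivector σ (petrovMetric k) e 2 p 0 1)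
      (frameBivector σ (petrovMetric k) e 0 p 0 2) (frameBivector σ (petrovMetric k) e 1 p 0 2) c i j,
    fun p hp => ⟨fun i j c => connectionTab_antisymm _ _ _ _ _ c i j,
      fun i c a b => covDeriv_frameBivector hk hUo h h0 h1 h2 hp i c a b⟩⟩

theorem im_eq_zero_of_sq_eq_ofReal {z : ℂ} {x : ℝ} (h : z ^ 2 = x) (hx : 0 < x) :
    z.im = 0 := by
  have hr := congrArg Complex.re h
  have hi := congrArg Complex.im h
  simp [pow_two] at hr hi
  by_contra h0
  have : z.re = 0 := by
    rcases mul_eq_zero.1 (show z.re * z.im = 0 by linarith) with h | h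
    exacts [h, absurd h h0]
  rw [this] at hr
  nlinarith [sq_nonneg z.im]

/-- Only the `y` component of `Γ_1^2` is nonzero. Multiplying the normalizations of `𝒰_1` and `𝒰_2`,
whose null factors have product `e^{-2x}`, shows that its square is `e^{-2x} > 0`, so it is real and
nonzero. The function `f` is its quotient by the only component `k⁻² e^{-2x}` of the 1-form of
`∂_y`. -/
theorem connection_proportional {k : ℝ} (hk : k ≠ 0) {σ : ℤˣ} {U : Set Pt} (hUo : IsOpen U)
    (hU : IsConnected U) {e : Fin 4 → Pt → Pt} {α : Fin 3 → Pt → ℂ}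
    (h : IsPrincipalFrame σ (petrovMetric k) U e α) (hα : ∀ p ∈ U, (α 2 p).im = 0)
    {Γ : Fin 3 → Fin 3 → Pt → Fin 4 → ℂ}
    (hΓ : IsConnection (petrovMetric k) U (frameBivector σ (petrovMetric k) e) Γ) :
    ∃ f : Pt → ℝ, ∀ p ∈ U, f p ≠ 0 ∧
      ∀ a, Γ 0 1 p a = ((f p * flat (petrovMetric k) translationY a p : ℝ) : ℂ) := by
  obtain ⟨τ, h0, h1, h2⟩ := exists_eigenType_of_real hk hU h hα
  refine ⟨fun p => (Γ 0 1 p 1).re / ((k ^ 2)⁻¹ * fA p), fun p hp => ?_⟩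
  have hA := fA_pos p
  have hA' : (fA p : ℂ) ≠ 0 := by exact_mod_cast hA.ne'
  have hkA : (k ^ 2)⁻¹ * fA p ≠ 0 := mul_ne_zero (inv_ne_zero (pow_ne_zero 2 hk)) hA.ne'
  have hk4 : (k : ℂ) ^ 4 ≠ 0 := by exact_mod_cast pow_ne_zero 4 hk
  have hn := fun i => (sdForm_frameBivector hk σ (h.2 p hp).1 i i).trans (if_pos rfl)
  have s0 := nullFactor_mul_sq hk (h0 p hp) (hn 0)
  have s1 := nullFactor_mul_sq hk (h1 p hp) (hn 1)
  have hN := nullFactor_mul τ p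
  have hv := (h0 p hp).2.2.2
  have hw := (h1 p hp).2.2.2
  -- The `xz` component of `∇𝒰_1` isolates `Γ_1^2`: antisymmetry removes `Γ_1^1`, and `(𝒰_3)_xz = 0`
  -- removes `Γ_1^3`. So the formula holds for every connection, not only for the one constructed
  -- above.
  have hform : ∀ c, Γ 0 1 p c = Complex.I * (σ : ℤ) * (-4⁻¹ / (k : ℂ) ^ 4) *
      (Complex.I * (τ : ℤ)) / (frameBivector σ (petrovMetric k) e 0 p 0 2 *
        frameBivector σ (petrovMetric k) e 1 p 0 2) * ![0, 1, 0, 0] c := fun c => by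
    have e1 := (hΓ p hp).2 0 c 0 2
    rw [covDeriv_frameBivector hk hUo h h0 h1 h2 hp 0 c 0 2, Fin.sum_univ_three,
      Fin.sum_univ_three, (h2 p hp).2.1, self_eq_neg.1 ((hΓ p hp).1 0 0 c)] at e1
    simp only [connectionTab] at e1
    simp only [Matrix.of_apply, Matrix.cons_val, mul_zero, add_zero, zero_mul, zero_add] at e1
    exact (mul_right_cancel₀ hw e1).symm
  generalize frameBivector σ (petrovMetric k) e 0 p 0 2 = v at *
  generalize frameBivector σ (petrovMetric k) e 1 p 0 2 = w at *
  have hsq : (Γ 0 1 p 1) ^ 2 = fA p := by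
    have hvw : fA p * (v * w) ^ 2 = (-4⁻¹ / (k : ℂ) ^ 4) ^ 2 := by
      rw [← hN]
      linear_combination nullFactor (-τ) p * w ^ 2 * s0 + (-4⁻¹ / (k : ℂ) ^ 4) * s1
    have hστ : (Complex.I * (σ : ℤ) * (Complex.I * (τ : ℤ))) ^ 2 = 1 := by
      rw [mul_pow, mul_pow, mul_pow, units_sq_complex, units_sq_complex, Complex.I_sq]; norm_num
    rw [hform]
    simp only [Matrix.cons_val, mul_one]
    rw [div_pow, div_eq_iff (pow_ne_zero 2 (mul_ne_zero hv hw)), hvw]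
    linear_combination (-4⁻¹ / (k : ℂ) ^ 4) ^ 2 * hστ
  have him := im_eq_zero_of_sq_eq_ofReal hsq hA
  have hre : ((Γ 0 1 p 1).re : ℂ) = Γ 0 1 p 1 := Complex.ext rfl (by simp [him])
  have hne : (Γ 0 1 p 1).re ≠ 0 := fun h0 => hA' (by rw [← hsq, ← hre, h0]; simp)
  refine ⟨div_ne_zero hne hkA, fun a => ?_⟩
  rw [flat_translationY]
  split_ifs with ha
  · rw [ha, div_mul_cancel₀ _ hkA, hre]
  · rw [hform]
    fin_cases a <;> simp at ha ⊢

theorem alignedWith_frameBivector {k : ℝ} (hk : k ≠ 0) {σ : ℤˣ} {U : Set Pt}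
    (hU : IsConnected U) {e : Fin 4 → Pt → Pt} {α : Fin 3 → Pt → ℂ}
    (h : IsPrincipalFrame σ (petrovMetric k) U e α) (hα : ∀ p ∈ U, (α 2 p).im = 0) :
    AlignedWith (petrovMetric k) U translationY (frameBivector σ (petrovMetric k) e 2) := by
  obtain ⟨τ, -, -, h2⟩ := exists_eigenType_of_real hk hU h hα
  refine alignedWith_translationY hk (σ := σ) fun p hp => ?_
  obtain ⟨-, f2, f3, f1⟩ := h2 p hp
  refine ⟨?_, f1⟩
  have := frameBivector_eq_sdTab hk σ e 2 p
  rwa [f2, f3] at this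

theorem im_petrovEigenvalue (k : ℝ) (σ : ℤˣ) (p : Pt) : (petrovEigenvalue k σ 2 p).im = 0 := by
  simp [petrovEigenvalue, ← Complex.ofReal_pow]

end Petrov

end

theorem mainTheorem6 (k : ℝ) (hk : k ≠ 0) (σ : ℤˣ) (U : Set Petrov.Pt) (hUo : IsOpen U)
    (hUc : IsConnected U) :
    -- vacuum
    (∀ p a b, Petrov.ricci (Petrov.petrovMetric k) a b p = 0) ∧
    -- Petrov type I: a Weyl principal frame, with distinct eigenvalues, the third one real
    (∃ e α, Petrov.IsPrincipalFrame σ (Petrov.petrovMetric k) U e α ∧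
      ∀ p ∈ U, Function.Injective (fun i => α i p) ∧ (α 2 p).im = 0) ∧
    -- exactly one eigenvalue is real
    (∀ e α, Petrov.IsPrincipalFrame σ (Petrov.petrovMetric k) U e α →
      ∃! i, ∀ p ∈ U, (α i p).im = 0) ∧
    -- exactly one Killing field with aligned Papapetrou field, up to scale
    ∃ ξ₀ : Petrov.Pt → Petrov.Pt,
      Petrov.IsKilling (Petrov.petrovMetric k) U ξ₀ ∧ (∀ p ∈ U, ξ₀ p ≠ 0) ∧
      Petrov.IsAligned σ (Petrov.petrovMetric k) U ξ₀ ∧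
      (∀ ξ, Petrov.IsKilling (Petrov.petrovMetric k) U ξ →
        Petrov.IsAligned σ (Petrov.petrovMetric k) U ξ → ∃ c : ℝ, ∀ p ∈ U, ξ p = c • ξ₀ p) ∧
      -- if `α₃` is the real eigenvalue, it is proportional to `Γ₁²` and aligned with `𝒰₃`
      ∀ e α, Petrov.IsPrincipalFrame σ (Petrov.petrovMetric k) U e α →
        (∀ p ∈ U, (α 2 p).im = 0) →
        Petrov.AlignedWith (Petrov.petrovMetric k) U ξ₀
          (Petrov.frameBivector σ (Petrov.petrovMetric k) e 2) ∧
        (∃ Γ, Petrov.IsConnection (Petrov.petrovMetric k) U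
          (Petrov.frameBivector σ (Petrov.petrovMetric k) e) Γ) ∧
        ∀ Γ, Petrov.IsConnection (Petrov.petrovMetric k) U
            (Petrov.frameBivector σ (Petrov.petrovMetric k) e) Γ →
          ∃ f : Petrov.Pt → ℝ, ∀ p ∈ U, f p ≠ 0 ∧
            ∀ a, Γ 0 1 p a = ((f p * Petrov.flat (Petrov.petrovMetric k) ξ₀ a p : ℝ) : ℂ) := by
  have hP := Petrov.isPrincipalFrame_petrovFrame hk σ U
  have hI := fun p (_ : p ∈ U) => Petrov.im_petrovEigenvalue k σ p
  refine ⟨fun p a b => Petrov.ricci_eq_zero hk a b p,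
    ⟨Petrov.petrovFrame k, Petrov.petrovEigenvalue k σ, hP,
      fun p hp => ⟨Petrov.injective_of_isPrincipalFrame hk hUc hP hp, hI p hp⟩⟩,
    fun e α h => Petrov.existsUnique_real_eigenvalue hk hUc h,
    Petrov.translationY, Petrov.isKilling_translationY hk U, fun p _ h => ?_,
    ⟨_, Petrov.isPrincipalBivector_frameBivector hk hP 2,
      Petrov.alignedWith_frameBivector hk hUc hP hI⟩,
    fun ξ hξ ha => Petrov.exists_eq_smul_translationY_of_isAligned hk hUo hUc.isPreconnected hξ ha,
    fun e α h hα => ⟨Petrov.alignedWith_frameBivector hk hUc h hα,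
      Petrov.exists_isConnection hk hUo hUc h hα,
      fun Γ hΓ => Petrov.connection_proportional hk hUo hUc h hα hΓ⟩⟩
  have := congrFun h 1
  simp [Petrov.translationY] at this
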